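/- Let $n\ge 1$ and let $S_n$ be the set of permutations $\pi=\pi_1\pi_2\cdots\pi_n$ of $[n]=\{1,\dots,n\}$. For $\pi\in S_n$ define the following statistics. - $\mathrm{wnm}(\pi)$ is the number of indices $i$ such that $\pi_i\ge i$ and there do not exist $j<i<k$ with $\pi_j>\pi_i>\pi_k$. - $\mathrm{rlm}(\pi)$ is the number of right-to-left maxima of the subword of $\pi$ to the left of the letter $1$, i.e. if $\pi_p=1$, the number of indices $i<p$ such that $\pi_i>\pi_j$ for all $j$ with $i<j<p$. - $\mathrm{rlmin}(\pi)$ is the number of right-to-left minima of $\pi$, i.e. the number of indices $i$ such that $\pi_i<\pi_j$ for all $j>i$. - $\mathrm{des}(\pi)$ is the number of $i\in[n-1]$ with $\pi_i>\pi_{i+1}$. - $(\underline{321})(\pi)$ is the number of occurrences of $321$ as a consecutive pattern, i.e. the number of $i$ with $1\le i\le n-2$ and $\pi_i>\pi_{i+1}>\pi_{i+2}$. Then the statistics $(\mathrm{rlm},\mathrm{rlmin},\mathrm{wnm},\mathrm{des},(\underline{321}))$ and $(\mathrm{rlm},\mathrm{wnm},\mathrm{rlmin},\mathrm{des},(\underline{321}))$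 are equally distributed on $S_n$: every $v\in\mathbb{Z}_{\ge0}^5$ is the value of the first at exactly as many permutations in $S_n$ as it is of the second. Moreover, $$\sum_{\pi\in S_n} x^{\mathrm{wnm}(\pi)-1}\,y^{\mathrm{rlm}(\pi)}=(x+y)_{n-1},$$ where $(z)_0=1$ and $(z)_m=z(z+1)\cdots(z+m-1)$ for $m\ge1$. (The identity holds for polynomials in the indeterminates $x,y$, hence for elements $x,y$ of any commutative semiring.) -/

import Mathlib

/-!
A permutation `π = π₁ π₂ ⋯ πₙ` of `[n]` is an element of `Equiv.Perm (Fin n)`. Positions and values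
are both numbered from `0`, so the letter `1` of the usual one-line notation is the value whose
underlying natural number is `0`. All the statistics below only compare positions with positions,
values with values, or a value with its position, so the common shift by one changes none of them.
-/

namespace PermStat

variable {n : ℕ}

/-- The index `i` is a weak excedance of `π`: `π_i ≥ i`. -/
abbrev IsWeakExcedance (π : Equiv.Perm (Fin n)) (i : Fin n) : Prop :=
  i ≤ π i

/-- The index `i` is a mid-point of `π`: there are `j < i < k` with `π_j > π_i > π_k`. -/
abbrev IsMidPoint (π : Equiv.Perm (Fin n)) (i : Fin n) : Prop :=
  (∃ j, j < i ∧ π i < π j) ∧ (∃ k, i < k ∧ π k < π i)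

/-- `WNM(π)`: the letters `π_i` with `i` a weak excedance and a non-mid-point of `π`. -/
def WNM (π : Equiv.Perm (Fin n)) : Finset (Fin n) :=
  (Finset.univ.filter fun i => IsWeakExcedance π i ∧ ¬ IsMidPoint π i).image π

/-- `wnm(π) = |WNM(π)|`. -/
def wnm (π : Equiv.Perm (Fin n)) : ℕ :=
  (WNM π).card

/-- `RLM(π)`: the RL-maxima of the subword of `π` to the left of the smallest letter, that is, the
letters `π_i` such that the smallest letter is at a position `p > i` and every letter strictly
between the positions `i` and `p` is smaller than `π_i`. -/
def RLM (π : Equiv.Perm (Fin n)) : Finset (Fin n) :=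
  (Finset.univ.filter fun i =>
    ∃ p, (π p : ℕ) = 0 ∧ i < p ∧ ∀ j, i < j → j < p → π j < π i).image π

/-- `rlm(π) = |RLM(π)|`. -/
def rlm (π : Equiv.Perm (Fin n)) : ℕ :=
  (RLM π).card

/-- `RLMIN(π)`: the RL-minima of `π`, the letters smaller than every letter to their right. -/
def RLMIN (π : Equiv.Perm (Fin n)) : Finset (Fin n) :=
  (Finset.univ.filter fun i => ∀ j, i < j → π i < π j).image π

/-- `rlmin(π) = |RLMIN(π)|`. -/
def rlmin (π : Equiv.Perm (Fin n)) : ℕ :=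
  (RLMIN π).card

/-- `des(π)`: the number of positions `i` that have a next position `j` with `π_i > π_j`. -/
def des (π : Equiv.Perm (Fin n)) : ℕ :=
  (Finset.univ.filter fun i : Fin n => ∃ j : Fin n, (j : ℕ) = (i : ℕ) + 1 ∧ π j < π i).card

/-- The number of occurrences in `π` of the consecutive pattern `321`: the number of positions `i`
that are followed by positions `j` and `k` with `π_i > π_j > π_k`. -/
def consec321 (π : Equiv.Perm (Fin n)) : ℕ :=
  (Finset.univ.filter fun i : Fin n => ∃ j k : Fin n,
    (j : ℕ) = (i : ℕ) + 1 ∧ (k : ℕ) = (i : ℕ) + 2 ∧ π j < π i ∧ π k < π j).card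

/-- For `n ≥ 1` the exponent `wnm π - 1` is never truncated. -/
theorem one_le_wnm (hn : 1 ≤ n) (π : Equiv.Perm (Fin n)) : 1 ≤ wnm π := by
  have key : ∀ v : Fin n, v ≤ (⟨n - 1, by omega⟩ : Fin n) := fun v => by
    have := v.isLt
    rw [Fin.le_def]
    simp only
    omega
  refine Finset.card_pos.mpr ⟨⟨n - 1, by omega⟩, Finset.mem_image.mpr
    ⟨π.symm ⟨n - 1, by omega⟩, Finset.mem_filter.mpr ⟨Finset.mem_univ _, ?_, ?_⟩, by simp⟩⟩
  · simpa [IsWeakExcedance] using key (π.symm ⟨n - 1, by omega⟩)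
  · rintro ⟨⟨j, _, hj⟩, _⟩
    rw [Equiv.apply_symm_apply] at hj
    exact absurd (key (π j)) (not_le.mpr hj)

end PermStat

/-! A permutation is a word with distinct letters, and its weak excedances that are not mid-points
are exactly its left-to-right maxima (`isWeakExcedance_and_not_isMidPoint_iff`). So the first claim
says that left-to-right maxima (marked by `x`) and right-to-left minima (marked by `y`) can be
exchanged while the other three statistics are kept. It is proved with generating functions indexed
by finite sets of letters and multiplied by `conv`.

Cutting a word at its smallest letter `a` splits off one right-to-left minimum and factors the
descent weight, but the left-to-right maxima after `a` depend on the largest letter before it. This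
forces a threshold `M`: only left-to-right maxima that are at least `M` are marked. The resulting
`lrrlSum` is not symmetric in `x` and `y`, since all letters below `M` lose their `x`. The remedy is
to multiply it by the series of words below `M` that carry `x` for each left-to-right maximum; this
product is `pairSum`.

When the smallest letter `a < M` is adjoined to a pair, it lands either in the first word, with a
factor `x`, or in the second after a prefix below `M`, with a factor `y`. Reverse complementation
(`lastSum_eq_maxFirstSum`) shows that both are multiplied by the same series, so together they give
`x + y`. All other terms carry `x * y` and a kernel free of `x` and `y`; removing `x` from that
kernel is the role of `conv_below_lrSum`. Thus `pairSum_insert` is a recursion with symmetric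
coefficients, whence `pairSum_symm`. The variable `z` for `rlm` enters only the kernel of one last
cut, in `sum_words_symm`. Equidistribution follows by comparing coefficients.

For the product formula, the last letter is removed: if it is the largest letter it contributes `x`,
if it is the smallest it contributes `y`, and any other letter contributes `1`. -/

namespace PermStat

/-! ### Algebra of set functions under the subset convolution. -/

section Convolution

variable {R : Type*} [CommSemiring R]

/-- The product of set functions: `conv f g T` is the sum of the
`f S * g (T \ S)` over the subsets `S` of `T`. -/
def conv (f g : Finset ℕ → R) (T : Finset ℕ) : R :=
  ∑ S ∈ T.powerset, f S * g (T \ S)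

theorem conv_congr {f f' g g' : Finset ℕ → R} {T : Finset ℕ} (hf : ∀ S ⊆ T, f S = f' S)
    (hg : ∀ S ⊆ T, g S = g' S) : conv f g T = conv f' g' T := by
  refine Finset.sum_congr rfl fun S hS => ?_
  rw [hf S (Finset.mem_powerset.mp hS), hg _ Finset.sdiff_subset]

theorem conv_comm (f g : Finset ℕ → R) : conv f g = conv g f := by
  funext T
  refine Finset.sum_nbij' (fun S => T \ S) (fun S => T \ S) ?_ ?_ ?_ ?_ ?_
  · intro S _; simp
  · intro S _; simp
  · intro S hS; simpa using Finset.mem_powerset.mp hS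
  · intro S hS; simpa using Finset.mem_powerset.mp hS
  · intro S hS
    rw [Finset.sdiff_sdiff_eq_self (Finset.mem_powerset.mp hS), mul_comm]

theorem conv_assoc (f g h : Finset ℕ → R) : conv (conv f g) h = conv f (conv g h) := by
  funext T
  simp only [conv, Finset.sum_mul, Finset.mul_sum]
  rw [Finset.sum_sigma', Finset.sum_sigma']
  refine Finset.sum_nbij' (fun p => ⟨p.2, p.1 \ p.2⟩) (fun p => ⟨p.1 ∪ p.2, p.1⟩) ?_ ?_ ?_ ?_ ?_
  · rintro ⟨S, S'⟩ h
    simp only [Finset.mem_sigma, Finset.mem_powerset] at h ⊢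
    exact ⟨h.2.trans h.1, Finset.sdiff_subset_sdiff h.1 le_rfl⟩
  · rintro ⟨S, S'⟩ h
    simp only [Finset.mem_sigma, Finset.mem_powerset] at h ⊢
    exact ⟨Finset.union_subset h.1 (h.2.trans Finset.sdiff_subset), Finset.subset_union_left⟩
  · rintro ⟨S, S'⟩ h
    simp only [Finset.mem_sigma, Finset.mem_powerset] at h
    simp [h.2]
  · rintro ⟨S, S'⟩ h
    simp only [Finset.mem_sigma, Finset.mem_powerset] at h
    have : (S ∪ S') \ S = S' := by
      rw [Finset.union_sdiff_left]
      exact Finset.sdiff_eq_self_of_disjoint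
        (Finset.disjoint_of_subset_left h.2 Finset.sdiff_disjoint)
    simp [this]
  · rintro ⟨S, S'⟩ h
    simp only [Finset.mem_sigma, Finset.mem_powerset] at h
    have : (T \ S') \ (S \ S') = T \ S := by
      ext b
      have := @h.2 b
      simp only [Finset.mem_sdiff]
      tauto
    simp only [this, mul_assoc]

theorem conv_left_comm (f g h : Finset ℕ → R) : conv f (conv g h) = conv g (conv f h) := by
  rw [← conv_assoc, conv_comm f g, conv_assoc]

theorem conv_const_mul_left (c : R) (f g : Finset ℕ → R) (T : Finset ℕ) :
    conv (fun S => c * f S) g T = c * conv f g T := by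
  simp [conv, Finset.mul_sum, mul_assoc]

theorem conv_const_mul_right (c : R) (f g : Finset ℕ → R) (T : Finset ℕ) :
    conv f (fun S => c * g S) T = c * conv f g T := by
  simp [conv, Finset.mul_sum, mul_left_comm]

theorem conv_add_right (f g g' : Finset ℕ → R) (T : Finset ℕ) :
    conv f (fun S => g S + g' S) T = conv f g T + conv f g' T := by
  simp [conv, mul_add, Finset.sum_add_distrib]

theorem conv_empty (f g : Finset ℕ → R) : conv f g ∅ = f ∅ * g ∅ := by
  simp [conv]

/-- Adjoining a point is a derivation of the product of set functions. -/
theorem conv_insert (f g : Finset ℕ → R) {a : ℕ} {U : Finset ℕ} (ha : a ∉ U) :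
    conv f g (insert a U) =
      conv (fun S => f (insert a S)) g U + conv f (fun S => g (insert a S)) U := by
  rw [conv, Finset.sum_powerset_insert ha, add_comm]
  congr 1 <;> refine Finset.sum_congr rfl fun S hS => ?_
  · have hS := Finset.mem_powerset.mp hS
    congr 2
    ext b
    simp only [Finset.mem_sdiff, Finset.mem_insert]
    have : b = a → b ∉ U := by rintro rfl; exact ha
    tauto
  · have hS := Finset.mem_powerset.mp hS
    rw [Finset.insert_sdiff_of_notMem _ (fun h => ha (hS h))]

/-- The restriction of a set function to the sets all of whose elements are smaller than `M`. -/
def below (M : ℕ) (f : Finset ℕ → R) (S : Finset ℕ) : R :=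
  if ∀ a ∈ S, a < M then f S else 0

theorem below_eq_zero {M : ℕ} {f : Finset ℕ → R} {S : Finset ℕ} {a : ℕ} (ha : a ∈ S)
    (hM : M ≤ a) : below M f S = 0 :=
  if_neg fun h => absurd (h a ha) (not_lt.mpr hM)

theorem below_conv (M : ℕ) (f g : Finset ℕ → R) :
    below M (conv f g) = conv (below M f) (below M g) := by
  funext T
  by_cases h : ∀ a ∈ T, a < M
  · rw [below, if_pos h]
    refine conv_congr (fun S hS => ?_) (fun S hS => ?_) <;>
      rw [below, if_pos fun a ha => h a (hS ha)]
  · rw [below, if_neg h, conv]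
    push Not at h
    obtain ⟨a, ha, hM⟩ := h
    refine (Finset.sum_eq_zero fun S _ => ?_).symm
    by_cases haS : a ∈ S
    · rw [below_eq_zero haS hM, zero_mul]
    · rw [below_eq_zero (Finset.mem_sdiff.mpr ⟨ha, haS⟩) hM, mul_zero]

theorem below_below {M N : ℕ} (h : M ≤ N) (f : Finset ℕ → R) : below N (below M f) = below M f := by
  funext S
  unfold below
  split_ifs with h1 h2 h2
  · rfl
  · rfl
  · exact absurd (fun a ha => (h2 a ha).trans_le h) h1
  · rfl

theorem below_insert {M a : ℕ} (h : a < M) (f : Finset ℕ → R) (S : Finset ℕ) :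
    below M f (insert a S) = below M (fun S => f (insert a S)) S := by
  simp [below, h]

theorem below_zero_conv {f g : Finset ℕ → R} (hf : f ∅ = 1) : conv (below 0 f) g = g := by
  funext T
  rw [conv, Finset.sum_eq_single ∅]
  · simp [below, hf]
  · intro S _ hS
    obtain ⟨a, ha⟩ := Finset.nonempty_iff_ne_empty.mpr hS
    rw [below_eq_zero ha (Nat.zero_le a), zero_mul]
  · simp

/-- If a set function is exponential with respect to the largest elements, then it is exponential
with respect to all elements. -/
theorem exp_insert {f k : Finset ℕ → R}
    (hf : ∀ (m : ℕ) (U : Finset ℕ), (∀ b ∈ U, b < m) →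
      f (insert m U) = conv (fun S => k (insert m S)) f U)
    (U : Finset ℕ) {a : ℕ} (ha : a ∉ U) :
    f (insert a U) = conv (fun S => k (insert a S)) f U := by
  induction U using Finset.strongInduction with
  | H U ih =>
  by_cases hU : ∀ b ∈ U, b < a
  · exact hf a U hU
  push Not at hU
  obtain ⟨b, hb, hab⟩ := hU
  obtain ⟨m, hm, hmax⟩ := U.exists_max_image id ⟨b, hb⟩
  simp only [id] at hmax
  obtain ⟨V, hmV, rfl⟩ : ∃ V, m ∉ V ∧ U = insert m V :=
    ⟨U.erase m, Finset.notMem_erase _ _, (Finset.insert_erase hm).symm⟩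
  have haV : a ∉ V := fun h => ha (Finset.mem_insert_of_mem h)
  have ham : a ≠ m := fun h => ha (h ▸ hm)
  have hV : ∀ b ∈ V, b < m := fun b hb =>
    lt_of_le_of_ne (hmax b (Finset.mem_insert_of_mem hb)) fun h => hmV (h ▸ hb)
  have haV' : ∀ b ∈ insert a V, b < m := by
    intro c hc
    rcases Finset.mem_insert.mp hc with rfl | hc
    · exact lt_of_le_of_ne (hab.trans (hmax b hb)) ham
    · exact hV c hc
  rw [Finset.insert_comm, hf m _ haV', conv_insert _ _ haV, conv_insert _ _ hmV]
  congr 1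
  -- After expanding at `m`, one summand has `a` and `m` in the same block. In the other, the
  -- induction hypothesis splits off the block of `a`, and the block of `m` is then absorbed back
  -- into `f`. The sum is the expansion at `m` of the desired right-hand side.
  · refine conv_congr (fun S _ => ?_) (fun _ _ => rfl)
    rw [Finset.insert_comm]
  · rw [conv_congr (T := V) (fun _ _ => rfl) (fun S hS =>
        ih S (Finset.ssubset_of_subset_of_ssubset hS (Finset.ssubset_insert hmV))
          fun h => haV (hS h)),
      conv_left_comm]
    exact conv_congr (fun _ _ => rfl) (fun S hS => (hf m S fun b hb => hV b (hS hb)).symm)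

/-- Sorting the subsets that are not below `M` by their largest element. -/
theorem sum_powerset_by_max (M : ℕ) (U : Finset ℕ) (ψ : Finset ℕ → R) :
    ∑ S ∈ U.powerset, (if ∀ b ∈ S, b < M then 0 else ψ S) =
      ∑ m ∈ U.filter (M ≤ ·), ∑ S ∈ (U.erase m).powerset, below m (fun S => ψ (insert m S)) S := by
  simp only [below]
  have : ∀ m, ∑ S ∈ (U.erase m).powerset, (if ∀ b ∈ S, b < m then ψ (insert m S) else 0) =
      ∑ S ∈ (U.erase m).powerset with ∀ b ∈ S, b < m, ψ (insert m S) := fun m => by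
    rw [Finset.sum_filter]
  simp only [this]
  have hL : ∑ S ∈ U.powerset, (if ∀ b ∈ S, b < M then 0 else ψ S) =
      ∑ S ∈ U.powerset with ¬ ∀ b ∈ S, b < M, ψ S := by
    rw [Finset.sum_filter]
    exact Finset.sum_congr rfl fun S _ => (ite_not _ _ _).symm
  rw [hL, Finset.sum_sigma']
  symm
  refine Finset.sum_bij (fun p _ => insert p.1 p.2) ?_ ?_ ?_ ?_
  · rintro ⟨m, S⟩ h
    simp only [Finset.mem_sigma, Finset.mem_filter, Finset.mem_powerset] at h ⊢
    refine ⟨Finset.insert_subset h.1.1 (h.2.1.trans (Finset.erase_subset _ _)), fun h' => ?_⟩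
    exact absurd (h' m (Finset.mem_insert_self _ _)) (not_lt.mpr h.1.2)
  · rintro ⟨m, S⟩ h ⟨m', S'⟩ h' he
    simp only [Finset.mem_sigma, Finset.mem_filter, Finset.mem_powerset] at h h' he
    have h1 : m ∈ insert m' S' := he ▸ Finset.mem_insert_self _ _
    have h2 : m' ∈ insert m S := he ▸ Finset.mem_insert_self _ _
    have hmm : m = m' := by
      rcases Finset.mem_insert.mp h1 with h1 | h1
      · exact h1
      rcases Finset.mem_insert.mp h2 with h2 | h2
      · exact h2.symm
      · exact absurd (h'.2.2 m h1) (not_lt.mpr (h.2.2 m' h2).le)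
    subst hmm
    have hS : m ∉ S := fun hm => lt_irrefl _ (h.2.2 m hm)
    have hS' : m ∉ S' := fun hm => lt_irrefl _ (h'.2.2 m hm)
    rw [← Finset.erase_insert hS, ← Finset.erase_insert hS', he]
  · intro S hS
    simp only [Finset.mem_filter, Finset.mem_powerset] at hS
    obtain ⟨hSU, hM⟩ := hS
    push Not at hM
    obtain ⟨b, hb, hMb⟩ := hM
    obtain ⟨m, hm, hmax⟩ := S.exists_max_image id ⟨b, hb⟩
    refine ⟨⟨m, S.erase m⟩, ?_, Finset.insert_erase hm⟩
    simp only [Finset.mem_sigma, Finset.mem_filter, Finset.mem_powerset]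
    refine ⟨⟨hSU hm, hMb.trans (hmax b hb)⟩, Finset.erase_subset_erase _ hSU, fun c hc => ?_⟩
    exact lt_of_le_of_ne (hmax c (Finset.mem_of_mem_erase hc)) (Finset.ne_of_mem_erase hc)
  · intros; rfl

/-- Interchange of summation: a set `S` and a marked point `m` outside `S` may be chosen in either
order. -/
theorem conv_sum_erase {M : ℕ} {f : Finset ℕ → R} (Ψ : ℕ → Finset ℕ → R) (U : Finset ℕ) :
    conv (below M f) (fun V => ∑ m ∈ V.filter (M ≤ ·), Ψ m (V.erase m)) U =
      ∑ m ∈ U.filter (M ≤ ·), conv (below M f) (Ψ m) (U.erase m) := by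
  simp only [conv, Finset.mul_sum]
  rw [Finset.sum_comm' (t' := U.filter (M ≤ ·)) (s' := fun m => (U.erase m).powerset)]
  · refine Finset.sum_congr rfl fun m _ => Finset.sum_congr rfl fun S _ => ?_
    rw [Finset.erase_sdiff_comm]
  · intro S m
    simp only [Finset.mem_powerset, Finset.mem_filter, Finset.mem_sdiff, Finset.subset_erase]
    tauto

end Convolution

/-! ### Words on a finite alphabet and their factorization at a letter. -/

section Words

/-- The words whose letters are the elements of `T`, each of them used once. -/
noncomputable def words (T : Finset ℕ) : Finset (List ℕ) :=
  T.toList.permutations.toFinset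

theorem mem_words {T : Finset ℕ} {w : List ℕ} : w ∈ words T ↔ w.Nodup ∧ w.toFinset = T := by
  rw [words, List.mem_toFinset, List.mem_permutations]
  constructor
  · intro h
    exact ⟨h.nodup_iff.mpr T.nodup_toList, by
      rw [List.toFinset_eq_of_perm _ _ h, T.toList_toFinset]⟩
  · rintro ⟨hw, rfl⟩
    exact (List.toFinset_toList hw).symm

theorem mem_of_mem_words {T : Finset ℕ} {w : List ℕ} (hw : w ∈ words T) {a : ℕ} :
    a ∈ w ↔ a ∈ T := by
  rw [← (mem_words.mp hw).2, List.mem_toFinset]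

theorem length_of_mem_words {T : Finset ℕ} {w : List ℕ} (hw : w ∈ words T) : w.length = T.card := by
  obtain ⟨h, rfl⟩ := mem_words.mp hw
  exact (List.toFinset_card_of_nodup h).symm

theorem words_empty : words ∅ = {[]} := by
  simp [words]

variable {R : Type*} [CommSemiring R]

/-- Cutting words at a given letter. -/
theorem sum_words_insert {a : ℕ} {U : Finset ℕ} (ha : a ∉ U) (φ : List ℕ → R) :
    ∑ w ∈ words (insert a U), φ w =
      ∑ S ∈ U.powerset, ∑ A ∈ words S, ∑ B ∈ words (U \ S), φ (A ++ a :: B) := by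
  simp only [Finset.sum_sigma']
  symm
  refine Finset.sum_bij (fun p _ => p.2.1 ++ a :: p.2.2) ?_ ?_ ?_ ?_
  · rintro ⟨S, A, B⟩ h
    simp only [Finset.mem_sigma, Finset.mem_powerset] at h
    obtain ⟨hS, hA, hB⟩ := h
    have hA' := mem_words.mp hA
    have hB' := mem_words.mp hB
    have haA : a ∉ A := fun h => ha (hS ((mem_of_mem_words hA).mp h))
    have haB : a ∉ B := fun h => ha (Finset.sdiff_subset ((mem_of_mem_words hB).mp h))
    rw [mem_words]
    refine ⟨?_, ?_⟩
    · rw [List.nodup_append, List.nodup_cons]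
      refine ⟨hA'.1, ⟨haB, hB'.1⟩, ?_⟩
      rintro b hb c hc rfl
      rcases List.mem_cons.mp hc with rfl | hc
      · exact haA hb
      · exact (Finset.mem_sdiff.mp ((mem_of_mem_words hB).mp hc)).2 ((mem_of_mem_words hA).mp hb)
    · rw [List.toFinset_append, List.toFinset_cons, hA'.2, hB'.2]
      rw [Finset.union_insert, Finset.union_sdiff_of_subset hS]
  · rintro ⟨S, A, B⟩ h ⟨S', A', B'⟩ h' he
    simp only [Finset.mem_sigma, Finset.mem_powerset] at h h' he
    have haA : a ∉ A := fun hh => ha (h.1 ((mem_of_mem_words h.2.1).mp hh))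
    have haA' : a ∉ A' := fun hh => ha (h'.1 ((mem_of_mem_words h'.2.1).mp hh))
    have hAA : A = A' := by
      have := congrArg (List.takeWhile (· ≠ a)) he
      rwa [List.takeWhile_append_of_pos, List.takeWhile_append_of_pos,
        List.takeWhile_cons_of_neg (by simp), List.takeWhile_cons_of_neg (by simp),
        List.append_nil, List.append_nil] at this
      · intro b hb; simpa using fun h : b = a => haA' (h ▸ hb)
      · intro b hb; simpa using fun h : b = a => haA (h ▸ hb)
    subst hAA
    have hBB : B = B' := by simpa using he
    subst hBB
    have : S = S' := by rw [← (mem_words.mp h.2.1).2, ← (mem_words.mp h'.2.1).2]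
    subst this
    rfl
  · intro w hw
    have hw' := mem_words.mp hw
    have haw : a ∈ w := (mem_of_mem_words hw).mpr (Finset.mem_insert_self _ _)
    obtain ⟨A, B, rfl⟩ := List.append_of_mem haw
    have hn := hw'.1
    rw [List.nodup_append, List.nodup_cons] at hn
    have haA : a ∉ A := fun h => hn.2.2 a h a (by simp) rfl
    have hU : ∀ b, b ∈ U ↔ b ∈ A ∨ b ∈ B := by
      intro b
      have h1 := mem_of_mem_words hw (a := b)
      simp only [List.mem_append, List.mem_cons, Finset.mem_insert] at h1
      by_cases hb : b = a
      · subst hb; simp [ha, haA, hn.2.1.1]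
      · simp only [hb, false_or] at h1; exact h1.symm
    refine ⟨⟨A.toFinset, A, B⟩, ?_, rfl⟩
    simp only [Finset.mem_sigma, Finset.mem_powerset]
    refine ⟨fun b hb => (hU b).mpr (Or.inl (List.mem_toFinset.mp hb)),
      mem_words.mpr ⟨hn.1, rfl⟩, mem_words.mpr ⟨hn.2.1.2, ?_⟩⟩
    ext b
    simp only [Finset.mem_sdiff, hU, List.mem_toFinset]
    have : b ∈ B → b ∉ A := fun hb hb' => hn.2.2 b hb' b (List.mem_cons_of_mem _ hb) rfl
    tauto
  · intros; rfl

end Words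

/-! ### Statistics of words and their behaviour under cutting. -/

section Statistics

/-- The number of left-to-right maxima of a word that are at least `M`. -/
def lrmax : ℕ → List ℕ → ℕ
  | _, [] => 0
  | M, a :: l => if M ≤ a then lrmax a l + 1 else lrmax M l

/-- The number of right-to-left maxima of a word. -/
def rlmax : List ℕ → ℕ
  | [] => 0
  | a :: l => rlmax l + if ∀ b ∈ l, b < a then 1 else 0

/-- The number of right-to-left minima of a word. -/
def rlminima : List ℕ → ℕ
  | [] => 0
  | a :: l => rlminima l + if ∀ b ∈ l, a < b then 1 else 0

theorem lrmax_eq_zero {M : ℕ} {w : List ℕ} (h : ∀ b ∈ w, b < M) : lrmax M w = 0 := by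
  induction w with
  | nil => rfl
  | cons a l ih =>
    rw [lrmax, if_neg (not_le.mpr (h a (by simp))), ih fun b hb => h b (by simp [hb])]

theorem lrmax_append_of_lt {M : ℕ} {A : List ℕ} (h : ∀ b ∈ A, b < M) (B : List ℕ) :
    lrmax M (A ++ B) = lrmax M B := by
  induction A with
  | nil => rfl
  | cons a l ih =>
    rw [List.cons_append, lrmax, if_neg (not_le.mpr (h a (by simp))),
      ih fun b hb => h b (by simp [hb])]

theorem lrmax_append_cons {M m : ℕ} {A : List ℕ} (hM : M ≤ m) (h : ∀ b ∈ A, b < m) (B : List ℕ) :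
    lrmax M (A ++ m :: B) = lrmax M A + 1 + lrmax m B := by
  induction A generalizing M with
  | nil => simp [lrmax, hM, add_comm]
  | cons a l ih =>
    have hl : ∀ b ∈ l, b < m := fun b hb => h b (by simp [hb])
    have ha : a ≤ m := (h a (by simp)).le
    rw [List.cons_append, lrmax, lrmax, ih ha hl, ih hM hl]
    split_ifs <;> ring

theorem lrmax_congr {M N : ℕ} {w : List ℕ} (hM : ∀ b ∈ w, M ≤ b) (hN : ∀ b ∈ w, N ≤ b) :
    lrmax M w = lrmax N w := by
  cases w with
  | nil => rfl
  | cons a l => rw [lrmax, lrmax, if_pos (hM a (by simp)), if_pos (hN a (by simp))]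

theorem rlmax_append_cons {m : ℕ} {A C : List ℕ} (hA : ∀ b ∈ A, b < m) (hC : ∀ b ∈ C, b < m) :
    rlmax (A ++ m :: C) = rlmax C + 1 := by
  induction A with
  | nil => rw [List.nil_append, rlmax, if_pos hC]
  | cons a l ih =>
    rw [List.cons_append, rlmax, ih fun b hb => hA b (by simp [hb]), if_neg, add_zero]
    intro h
    exact absurd (h m (by simp)) (not_lt.mpr (hA a (by simp)).le)

theorem rlminima_append_cons {a : ℕ} {A B : List ℕ} (hA : ∀ b ∈ A, a < b) (hB : ∀ b ∈ B, a < b) :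
    rlminima (A ++ a :: B) = rlminima B + 1 := by
  induction A with
  | nil => rw [List.nil_append, rlminima, if_pos hB]
  | cons c l ih =>
    rw [List.cons_append, rlminima, ih fun b hb => hA b (by simp [hb]), if_neg, add_zero]
    intro h
    exact absurd (h a (by simp)) (not_lt.mpr (hA c (by simp)).le)

variable {R : Type*} [CommSemiring R]

/-- The product of a factor `t` for each descent and of a factor `q` for each consecutive double
descent of a word. -/
def wt (t q : R) : List ℕ → R
  | [] => 1
  | [_] => 1
  | [a, b] => if b < a then t else 1
  | a :: b :: c :: l =>
    (if b < a then t else 1) * (if b < a ∧ c < b then q else 1) * wt t q (b :: c :: l)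

/-- No descent or double descent can use the ascent from `a` to `b`, so the weight factors there.
Cutting just after a smallest letter or just before a largest one is a special case. -/
theorem wt_append_of_lt (t q : R) (A : List ℕ) {a b : ℕ} (h : a < b) (B : List ℕ) :
    wt t q (A ++ a :: b :: B) = wt t q (A ++ [a]) * wt t q (b :: B) := by
  induction A using List.twoStepInduction with
  | nil => cases B <;> simp [wt, not_lt.mpr h.le]
  | singleton c => cases B <;> simp [wt, not_lt.mpr h.le]
  | cons_cons c d l ih1 ih2 =>
    cases l with
    | nil =>
      simp only [List.cons_append, List.nil_append, wt] at ih2 ⊢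
      rw [ih2, ← mul_assoc]
    | cons e l =>
      have := ih2 d
      simp only [List.cons_append, wt] at this ⊢
      rw [this, ← mul_assoc]

theorem wt_append_min (t q : R) (A : List ℕ) {a : ℕ} {B : List ℕ} (hB : ∀ b ∈ B, a < b) :
    wt t q (A ++ a :: B) = wt t q (A ++ [a]) * wt t q B := by
  cases B with
  | nil => simp [wt]
  | cons b B => exact wt_append_of_lt t q A (hB b (by simp)) B

theorem wt_append_max (t q : R) {m : ℕ} {A : List ℕ} (hA : ∀ b ∈ A, b < m) (B : List ℕ) :
    wt t q (A ++ m :: B) = wt t q A * wt t q (m :: B) := by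
  rcases A.eq_nil_or_concat with rfl | ⟨A, a, rfl⟩
  · simp [wt]
  · rw [List.concat_eq_append, List.append_assoc, List.singleton_append]
    exact wt_append_of_lt t q A (hA a (by simp)) B

theorem wt_append_triple (t q : R) (A : List ℕ) (a b c : ℕ) :
    wt t q (A ++ [a, b, c]) =
      wt t q (A ++ [a, b]) * ((if c < b then t else 1) * (if b < a ∧ c < b then q else 1)) := by
  induction A using List.twoStepInduction with
  | nil => simp only [List.nil_append, wt]; ring
  | singleton d => simp only [List.cons_append, List.nil_append, wt]; ring
  | cons_cons d e l ih1 ih2 =>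
    cases l with
    | nil => simp only [List.cons_append, List.nil_append, wt]; ring
    | cons f l =>
      have := ih2 e
      simp only [List.cons_append, wt] at this ⊢
      rw [this]
      ring

/-- The reverse complement of a word has the same weight. -/
theorem wt_reverse_map (t q : R) {ρ : ℕ → ℕ} {w : List ℕ}
    (hρ : ∀ a ∈ w, ∀ b ∈ w, a < b ↔ ρ b < ρ a) : wt t q (w.map ρ).reverse = wt t q w := by
  induction w with
  | nil => rfl
  | cons a w ih =>
    have ih := ih fun b hb c hc => hρ b (by simp [hb]) c (by simp [hc])
    match w with
    | [] => simp [wt]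
    | [b] => simp [wt, hρ b (by simp) a (by simp)]
    | b :: c :: l =>
      simp only [List.map_cons, List.reverse_cons, List.append_assoc, List.cons_append,
        List.nil_append] at ih ⊢
      rw [wt_append_triple, ih, wt]
      simp only [hρ b (by simp) a (by simp), hρ c (by simp) b (by simp),
        and_comm (a := ρ b < ρ c)]
      ring

end Statistics

/-! ### Weighted sums over words, and their exponential structure. -/

section GeneratingFunctions

variable {R : Type*} [CommSemiring R]

/-- The weighted number of words. -/
noncomputable def wordSum (t q : R) (S : Finset ℕ) : R :=
  ∑ w ∈ words S, wt t q w

/-- The weighted sum of words, by the number of left-to-right maxima that are at least `M`. -/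
noncomputable def lrSum (t q x : R) (M : ℕ) (S : Finset ℕ) : R :=
  ∑ w ∈ words S, x ^ lrmax M w * wt t q w

/-- The weighted sum of words, by the number of left-to-right maxima that are at least `M` and the
number of right-to-left minima. -/
noncomputable def lrrlSum (t q x y : R) (M : ℕ) (S : Finset ℕ) : R :=
  ∑ w ∈ words S, x ^ lrmax M w * y ^ rlminima w * wt t q w

/-- The weighted sum of the words on `X` that start with the largest element of `X`. -/
noncomputable def maxFirstSum (t q : R) (X : Finset ℕ) : R :=
  ∑ w ∈ words (X.erase (X.sup id)), wt t q (X.sup id :: w)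

/-- The weighted sum of the words that end with `a`. -/
noncomputable def lastSum (t q z : R) (a : ℕ) (S : Finset ℕ) : R :=
  ∑ w ∈ words S, z ^ rlmax w * wt t q (w ++ [a])

/-- The weighted sum of the words that start with `m` and end with `a`. -/
noncomputable def firstLastSum (t q z : R) (m a : ℕ) (S : Finset ℕ) : R :=
  ∑ w ∈ words S, z ^ (rlmax w + 1) * wt t q (m :: (w ++ [a]))

theorem lrSum_empty (t q x : R) (M : ℕ) : lrSum t q x M ∅ = 1 := by
  simp [lrSum, words_empty, wt, lrmax]

theorem lrSum_of_lt (t q x : R) {M : ℕ} {S : Finset ℕ} (h : ∀ b ∈ S, b < M) :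
    lrSum t q x M S = wordSum t q S := by
  refine Finset.sum_congr rfl fun w hw => ?_
  rw [lrmax_eq_zero fun b hb => h b ((mem_of_mem_words hw).mp hb), pow_zero, one_mul]

theorem maxFirstSum_insert (t q : R) {m : ℕ} {S : Finset ℕ} (h : ∀ b ∈ S, b < m) :
    maxFirstSum t q (insert m S) = ∑ w ∈ words S, wt t q (m :: w) := by
  have hm : (insert m S).sup id = m := by
    rw [Finset.sup_insert, id, sup_eq_left]
    exact Finset.sup_le fun b hb => (h b hb).le
  rw [maxFirstSum, hm, Finset.erase_insert fun hm => lt_irrefl _ (h m hm)]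

/-- The complement map on letters: `Fin.rev` transported along the increasing enumeration of `X`,
and the identity off `X`. -/
theorem exists_antitone_involution (X : Finset ℕ) : ∃ ρ : ℕ → ℕ,
    (∀ a ∈ X, ρ a ∈ X) ∧ (∀ a ∈ X, ρ (ρ a) = a) ∧
      ∀ a ∈ X, ∀ b ∈ X, a < b ↔ ρ b < ρ a := by
  classical
  set e := X.orderIsoOfFin rfl with he
  refine ⟨fun a => if h : a ∈ X then e (Fin.rev (e.symm ⟨a, h⟩)) else a, ?_, ?_, ?_⟩
  · intro a ha
    simp only [ha, dif_pos]
    exact (e _).2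
  · intro a ha
    simp [ha]
  · intro a ha b hb
    simp [ha, hb]

/-- Reverse complementation turns the words that start with their largest letter into the words
that end with their smallest one. -/
theorem lastSum_eq_maxFirstSum (t q : R) {a : ℕ} {S : Finset ℕ} (h : ∀ b ∈ S, a < b) :
    lastSum t q 1 a S = maxFirstSum t q (insert a S) := by
  have haS : a ∉ S := fun ha => lt_irrefl _ (h a ha)
  set X := insert a S with hX
  have haX : a ∈ X := Finset.mem_insert_self _ _
  obtain ⟨m, hm, hmax⟩ := X.exists_max_image id ⟨a, haX⟩
  simp only [id] at hmax
  have hXm : X = insert m (X.erase m) := (Finset.insert_erase hm).symm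
  have hlt : ∀ b ∈ X.erase m, b < m := fun b hb =>
    lt_of_le_of_ne (hmax b (Finset.mem_of_mem_erase hb)) (Finset.ne_of_mem_erase hb)
  have hSX : S = X.erase a := (Finset.erase_insert haS).symm
  rw [hXm, maxFirstSum_insert t q hlt, lastSum]
  obtain ⟨ρ, hρX, hρρ, hρlt⟩ := exists_antitone_involution X
  have hmin : ∀ b ∈ X, a ≤ b := by
    intro b hb
    rcases Finset.mem_insert.mp hb with rfl | hb
    · exact le_rfl
    · exact (h b hb).le
  have hρa : ρ a = m := by
    refine le_antisymm (hmax _ (hρX a haX)) (not_lt.mp fun hlt => ?_)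
    rw [← hρρ m hm, ← hρlt _ (hρX m hm) _ haX] at hlt
    exact absurd (hmin _ (hρX m hm)) (not_le.mpr hlt)
  have hρm : ρ m = a := by rw [← hρa, hρρ a haX]
  have key : ∀ b ∈ X, ∀ w ∈ words (X.erase b),
      (w.map ρ).reverse ∈ words (X.erase (ρ b)) ∧ ((w.map ρ).reverse.map ρ).reverse = w := by
    intro b hb w hw
    have hwX : ∀ c ∈ w, c ∈ X := fun c hc =>
      Finset.mem_of_mem_erase ((mem_of_mem_words hw).mp hc)
    have hinv : (w.map ρ).map ρ = w := by
      rw [List.map_map]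
      exact (List.map_congr_left fun c hc => hρρ c (hwX c hc)).trans (List.map_id w)
    refine ⟨mem_words.mpr ⟨?_, ?_⟩, ?_⟩
    · rw [List.nodup_reverse]
      refine List.Nodup.of_map ρ ?_
      rw [hinv]
      exact (mem_words.mp hw).1
    · ext c
      simp only [List.mem_toFinset, List.mem_reverse, List.mem_map, Finset.mem_erase,
        mem_of_mem_words hw]
      constructor
      · rintro ⟨d, ⟨hdb, hd⟩, rfl⟩
        refine ⟨fun he => hdb ?_, hρX d hd⟩
        rw [← hρρ d hd, he, hρρ b hb]
      · rintro ⟨hcb, hc⟩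
        refine ⟨ρ c, ⟨fun he => hcb ?_, hρX c hc⟩, hρρ c hc⟩
        rw [← he, hρρ c hc]
    · rw [List.map_reverse, List.reverse_reverse, hinv]
  refine Finset.sum_nbij' (fun w => (w.map ρ).reverse) (fun w => (w.map ρ).reverse) ?_ ?_ ?_ ?_ ?_
  · intro w hw
    rw [hSX] at hw
    have := (key a haX w hw).1
    rwa [hρa] at this
  · intro w hw
    have := (key m hm w hw).1
    rwa [hρm, ← hSX] at this
  · intro w hw
    rw [hSX] at hw
    exact (key a haX w hw).2
  · intro w hw
    exact (key m hm w hw).2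
  · intro w hw
    rw [one_pow, one_mul]
    have hwX : ∀ c ∈ w ++ [a], c ∈ X := by
      intro c hc
      rcases List.mem_append.mp hc with hc | hc
      · exact Finset.mem_insert_of_mem ((mem_of_mem_words hw).mp hc)
      · rwa [List.mem_singleton.mp hc]
    rw [← wt_reverse_map t q (ρ := ρ) (w := w ++ [a]) fun b hb c hc => hρlt b (hwX b hb) c (hwX c hc)]
    simp [hρa]

/-- Cutting words at their largest letter. -/
theorem lrSum_insert_max (t q x : R) {M m : ℕ} {U : Finset ℕ} (hU : ∀ b ∈ U, b < m) (hM : M ≤ m) :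
    lrSum t q x M (insert m U) =
      conv (fun S => x * maxFirstSum t q (insert m S)) (lrSum t q x M) U := by
  rw [conv_comm, lrSum, sum_words_insert fun hm => lt_irrefl _ (hU m hm)]
  refine Finset.sum_congr rfl fun S hS => ?_
  have hS := Finset.mem_powerset.mp hS
  beta_reduce
  rw [maxFirstSum_insert t q fun b hb => hU b (Finset.sdiff_subset hb), lrSum, Finset.mul_sum,
    Finset.sum_mul_sum]
  refine Finset.sum_congr rfl fun A hA => Finset.sum_congr rfl fun B hB => ?_
  have hA' : ∀ b ∈ A, b < m := fun b hb => hU b (hS ((mem_of_mem_words hA).mp hb))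
  have hB' : ∀ b ∈ B, b < m := fun b hb =>
    hU b (Finset.sdiff_subset ((mem_of_mem_words hB).mp hb))
  rw [lrmax_append_cons hM hA', wt_append_max t q hA', lrmax_eq_zero hB']
  ring

/-- Left-to-right maxima cut a word into blocks that start with their largest letter, each worth
`x`. As `maxFirstSum` depends only on the letter set of a block, the block containing any chosen
letter can be split off, not just that of the largest letter. Here `a` will be the smallest one. -/
theorem lrSum_insert (t q x : R) {a : ℕ} {U : Finset ℕ} (ha : a ∉ U) :
    lrSum t q x 0 (insert a U) =
      conv (fun S => x * maxFirstSum t q (insert a S)) (lrSum t q x 0) U :=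
  exp_insert (k := fun X => x * maxFirstSum t q X)
    (fun m _ hU => lrSum_insert_max t q x hU (Nat.zero_le m)) U ha

/-- Heuristically, `lrSum` at threshold `M` is `lrSum` at threshold `0` with its factor below `M`
replaced by the unmarked `wordSum`. With denominators cleared, both sides obey the same recursion on
adjoining a largest letter `m ≥ M`, because the restricted factors vanish on sets that contain `m`.
-/
theorem conv_below_lrSum (t q x : R) (M : ℕ) :
    conv (below M (lrSum t q x 0)) (lrSum t q x M) =
      conv (below M (wordSum t q)) (lrSum t q x 0) := by
  funext T
  induction T using Finset.strongInduction with
  | H T ih =>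
  by_cases hT : ∀ b ∈ T, b < M
  · rw [conv_comm]
    refine conv_congr (fun S hS => ?_) (fun S hS => ?_)
    · rw [lrSum_of_lt t q x fun b hb => hT b (hS hb), below, if_pos fun b hb => hT b (hS hb)]
    · rw [below, if_pos fun b hb => hT b (hS hb)]
  push Not at hT
  obtain ⟨b, hb, hMb⟩ := hT
  obtain ⟨m, hm, hmax⟩ := T.exists_max_image id ⟨b, hb⟩
  simp only [id] at hmax
  have hMm : M ≤ m := hMb.trans (hmax b hb)
  obtain ⟨U, hmU, rfl⟩ : ∃ V, m ∉ V ∧ T = insert m V :=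
    ⟨T.erase m, Finset.notMem_erase _ _, (Finset.insert_erase hm).symm⟩
  have hU : ∀ b ∈ U, b < m := fun b hb =>
    lt_of_le_of_ne (hmax b (Finset.mem_insert_of_mem hb)) fun h => hmU (h ▸ hb)
  have hzero : ∀ f g : Finset ℕ → R, conv (fun S => below M f (insert m S)) g U = 0 := fun f g =>
    Finset.sum_eq_zero fun S _ => by
      beta_reduce
      rw [below_eq_zero (Finset.mem_insert_self m S) hMm, zero_mul]
  rw [conv_insert _ _ hmU, conv_insert _ _ hmU, hzero, hzero, zero_add, zero_add,
    conv_congr (T := U) (fun _ _ => rfl)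
      (fun S hS => lrSum_insert_max t q x (fun b hb => hU b (hS hb)) hMm),
    conv_congr (T := U) (fun _ _ => rfl)
      (fun S hS => lrSum_insert_max t q x (fun b hb => hU b (hS hb)) (Nat.zero_le m)),
    conv_left_comm (below M (lrSum t q x 0)), conv_left_comm (below M (wordSum t q))]
  exact conv_congr (fun _ _ => rfl) fun S hS =>
    ih S (Finset.ssubset_of_subset_of_ssubset hS (Finset.ssubset_insert hmU))

end GeneratingFunctions

/-! ### The recursion at the smallest letter and the symmetry in `x` and `y`. -/

section Symmetry

variable {R : Type*} [CommSemiring R]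

/-- Cutting words at their smallest letter `a`, and the part before it at its largest letter if
that is at least `M`. -/
theorem sum_cut_min (t q x y z : R) (M : ℕ) {a : ℕ} {U : Finset ℕ} (hU : ∀ b ∈ U, a < b) :
    ∑ S ∈ U.powerset, ∑ A ∈ words S, ∑ B ∈ words (U \ S), z ^ rlmax A *
        (x ^ lrmax M (A ++ a :: B) * y ^ rlminima (A ++ a :: B) * wt t q (A ++ a :: B)) =
      (if a < M then y * conv (below M (lastSum t q z a)) (lrrlSum t q x y M) U
        else x * y * lrrlSum t q x y M U) +
      x * y * ∑ m ∈ U.filter (M ≤ ·), conv (below m (lrSum t q x M))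
        (conv (below m (firstLastSum t q z m a)) (lrrlSum t q x y m)) (U.erase m) := by
  set ψ : Finset ℕ → R := fun S => ∑ A ∈ words S, ∑ B ∈ words (U \ S), z ^ rlmax A *
        (x ^ lrmax M (A ++ a :: B) * y ^ rlminima (A ++ a :: B) * wt t q (A ++ a :: B)) with hψ
  have hsplit : ∑ S ∈ U.powerset, ψ S =
      ∑ S ∈ U.powerset, (if ∀ b ∈ S, b < M then ψ S else 0) +
      ∑ S ∈ U.powerset, (if ∀ b ∈ S, b < M then 0 else ψ S) := by
    rw [← Finset.sum_add_distrib]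
    refine Finset.sum_congr rfl fun S _ => ?_
    split_ifs <;> simp
  rw [hsplit, sum_powerset_by_max, Finset.mul_sum]
  congr 1
  · by_cases haM : a < M
    · rw [if_pos haM, ← conv_const_mul_left]
      refine Finset.sum_congr rfl fun S hS => ?_
      have hS := Finset.mem_powerset.mp hS
      simp only [below]
      split_ifs with hSM
      · rw [lastSum, lrrlSum, mul_assoc, Finset.sum_mul_sum, Finset.mul_sum]
        refine Finset.sum_congr rfl fun A hA => ?_
        rw [Finset.mul_sum]
        refine Finset.sum_congr rfl fun B hB => ?_
        have hA' : ∀ b ∈ A, a < b := fun b hb => hU b (hS ((mem_of_mem_words hA).mp hb))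
        have hAM : ∀ b ∈ A, b < M := fun b hb => hSM b ((mem_of_mem_words hA).mp hb)
        have hB' : ∀ b ∈ B, a < b := fun b hb =>
          hU b (Finset.sdiff_subset ((mem_of_mem_words hB).mp hb))
        rw [lrmax_append_of_lt hAM, lrmax, if_neg (not_le.mpr haM), rlminima_append_cons hA' hB',
          wt_append_min t q A hB']
        ring
      · simp
    -- Now `M ≤ a`, so every letter of `U` exceeds `M` and only the empty prefix lies below `M`. The
    -- letter `a` comes first and is both a counted left-to-right maximum and a right-to-left
    -- minimum, hence `x * y`.
    · rw [if_neg haM, Finset.sum_eq_single ∅]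
      · have hMa := not_lt.mp haM
        simp only [Finset.notMem_empty, false_imp_iff, implies_true, if_true, hψ, words_empty,
          Finset.sum_singleton, Finset.sdiff_empty, lrrlSum, Finset.mul_sum]
        refine Finset.sum_congr rfl fun B hB => ?_
        have hB' : ∀ b ∈ B, a < b := fun b hb => hU b ((mem_of_mem_words hB).mp hb)
        rw [rlminima_append_cons (by simp) hB', wt_append_min t q [] hB', List.nil_append, lrmax,
          if_pos hMa, lrmax_congr (M := a) (N := M) (fun b hb => (hB' b hb).le)
            fun b hb => hMa.trans (hB' b hb).le]
        simp only [rlmax, wt, List.nil_append]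
        ring
      · intro S hS hne
        obtain ⟨b, hb⟩ := Finset.nonempty_iff_ne_empty.mpr hne
        refine if_neg fun h => haM ?_
        exact (hU b (Finset.mem_powerset.mp hS hb)).trans (h b hb)
      · simp
  · refine Finset.sum_congr rfl fun m hm => ?_
    obtain ⟨hmU, hMm⟩ := Finset.mem_filter.mp hm
    have ham := hU m hmU
    -- The prefix is `A ++ m :: C` with largest letter `m ≥ M`, so the two series for `A` and `C`
    -- are jointly restricted below `m`, and the threshold for the word after `a` rises to `m`.
    rw [← conv_assoc, ← below_conv, ← conv_const_mul_left]
    refine Finset.sum_congr rfl fun S hS => ?_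
    have hS := Finset.mem_powerset.mp hS
    simp only [below]
    split_ifs with hSm
    swap
    · simp
    have hmS : m ∉ S := fun h => lt_irrefl _ (hSm m h)
    simp only [hψ]
    rw [sum_words_insert hmS, conv, Finset.mul_sum, Finset.sum_mul]
    refine Finset.sum_congr rfl fun S' hS' => ?_
    have hS' := Finset.mem_powerset.mp hS'
    have hset : U \ insert m S = U.erase m \ S := by
      ext b; simp only [Finset.mem_sdiff, Finset.mem_insert, Finset.mem_erase]; tauto
    rw [hset, lrSum, firstLastSum, Finset.sum_mul_sum, Finset.mul_sum, Finset.sum_mul]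
    refine Finset.sum_congr rfl fun A hA => ?_
    rw [Finset.mul_sum, Finset.sum_mul]
    refine Finset.sum_congr rfl fun C hC => ?_
    rw [lrrlSum, Finset.mul_sum]
    refine Finset.sum_congr rfl fun B hB => ?_
    have hSU : ∀ b ∈ S, b ∈ U := fun b hb => Finset.mem_of_mem_erase (hS hb)
    have hAS : ∀ b ∈ A, b ∈ S := fun b hb => hS' ((mem_of_mem_words hA).mp hb)
    have hCS : ∀ b ∈ C, b ∈ S := fun b hb => Finset.sdiff_subset ((mem_of_mem_words hC).mp hb)
    have hAm : ∀ b ∈ A, b < m := fun b hb => hSm b (hAS b hb)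
    have hCm : ∀ b ∈ C, b < m := fun b hb => hSm b (hCS b hb)
    have hB' : ∀ b ∈ B, a < b := fun b hb =>
      hU b (Finset.mem_of_mem_erase (Finset.sdiff_subset ((mem_of_mem_words hB).mp hb)))
    have hpre : ∀ b ∈ A ++ m :: C, a < b := by
      intro b hb
      simp only [List.mem_append, List.mem_cons] at hb
      rcases hb with hb | rfl | hb
      · exact hU b (hSU b (hAS b hb))
      · exact ham
      · exact hU b (hSU b (hCS b hb))
    have hl : lrmax M (A ++ m :: C ++ a :: B) = lrmax M A + 1 + lrmax m B := by
      rw [List.append_assoc, List.cons_append, lrmax_append_cons hMm hAm,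
        lrmax_append_of_lt hCm, lrmax, if_neg (not_le.mpr ham)]
    have hw : wt t q (A ++ m :: C ++ a :: B) =
        wt t q A * wt t q (m :: (C ++ [a])) * wt t q B := by
      rw [wt_append_min t q _ hB', List.append_assoc, List.cons_append, wt_append_max t q hAm]
    -- The right-to-left maxima of the prefix are `m` and those of `C`; this is the exponent `rlmax
    -- w + 1` in `firstLastSum`.
    rw [hl, hw, rlminima_append_cons hpre hB', rlmax_append_cons hAm hCm]
    ring

/-- Pairs of words, the first one with all letters below `M`. -/
noncomputable def pairSum (t q x y : R) (M : ℕ) : Finset ℕ → R :=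
  conv (below M (lrSum t q x 0)) (lrrlSum t q x y M)

theorem lrrlSum_insert (t q x y : R) (M : ℕ) {a : ℕ} {U : Finset ℕ} (hU : ∀ b ∈ U, a < b) :
    lrrlSum t q x y M (insert a U) =
      (if a < M then y * conv (below M (lastSum t q 1 a)) (lrrlSum t q x y M) U
        else x * y * lrrlSum t q x y M U) +
      x * y * ∑ m ∈ U.filter (M ≤ ·), conv (below m (lrSum t q x M))
        (conv (below m (firstLastSum t q 1 m a)) (lrrlSum t q x y m)) (U.erase m) := by
  rw [← sum_cut_min t q x y 1 M hU, lrrlSum, sum_words_insert fun ha => lt_irrefl _ (hU a ha)]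
  simp

/-- Since adjoining a point is a derivation, `a` joins either the first or the second word of a
pair. The right-hand side involves `x` and `y` only through `x + y`, `x * y` and `pairSum` on
smaller sets. -/
theorem pairSum_insert (t q x y : R) (M : ℕ) {a : ℕ} {U : Finset ℕ} (hU : ∀ b ∈ U, a < b) :
    pairSum t q x y M (insert a U) =
      (if a < M then (x + y) * conv (below M fun S => maxFirstSum t q (insert a S))
          (pairSum t q x y M) U
        else x * y * pairSum t q x y M U) +
      x * y * ∑ m ∈ U.filter (M ≤ ·), conv (below M (wordSum t q))
        (conv (below m (firstLastSum t q 1 m a)) (pairSum t q x y m)) (U.erase m) := by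
  have haU : a ∉ U := fun ha => lt_irrefl _ (hU a ha)
  have hsum : conv (below M (lrSum t q x 0)) (fun S => x * y * ∑ m ∈ S.filter (M ≤ ·),
        conv (below m (lrSum t q x M)) (conv (below m (firstLastSum t q 1 m a))
          (lrrlSum t q x y m)) (S.erase m)) U =
      x * y * ∑ m ∈ U.filter (M ≤ ·), conv (below M (wordSum t q))
        (conv (below m (firstLastSum t q 1 m a)) (pairSum t q x y m)) (U.erase m) := by
    rw [conv_const_mul_right]
    congr 1
    rw [conv_sum_erase fun m => conv (below m (lrSum t q x M))
      (conv (below m (firstLastSum t q 1 m a)) (lrrlSum t q x y m))]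
    refine Finset.sum_congr rfl fun m hm => ?_
    have hMm := (Finset.mem_filter.mp hm).2
    -- Inside `below m`, `conv_below_lrSum` trades the two marked series for an unmarked one below
    -- `M` and `lrSum` at threshold `0`. The latter, restricted below `m`, is exactly the factor
    -- that completes `lrrlSum` at threshold `m` to `pairSum`.
    rw [← conv_assoc (below M (lrSum t q x 0)), ← below_below hMm (lrSum t q x 0), ← below_conv,
      conv_below_lrSum, below_conv, below_below hMm, conv_assoc,
      conv_left_comm (below m (lrSum t q x 0))]
    rfl
  have hstep : conv (below M (lrSum t q x 0)) (fun S => lrrlSum t q x y M (insert a S)) U =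
      conv (below M (lrSum t q x 0)) (fun S =>
        (if a < M then y * conv (below M (lastSum t q 1 a)) (lrrlSum t q x y M) S
          else x * y * lrrlSum t q x y M S) +
        x * y * ∑ m ∈ S.filter (M ≤ ·), conv (below m (lrSum t q x M))
          (conv (below m (firstLastSum t q 1 m a)) (lrrlSum t q x y m)) (S.erase m)) U :=
    conv_congr (fun _ _ => rfl) fun S hS => lrrlSum_insert t q x y M fun b hb => hU b (hS hb)
  rw [pairSum, conv_insert _ _ haU, hstep, conv_add_right, hsum, ← add_assoc]
  congr 1
  by_cases haM : a < M
  · simp only [if_pos haM]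
    rw [conv_const_mul_right, conv_left_comm, add_mul]
    have h1 : conv (fun S => below M (lrSum t q x 0) (insert a S)) (lrrlSum t q x y M) U =
        conv (conv (fun S => x * below M (fun S => maxFirstSum t q (insert a S)) S)
          (below M (lrSum t q x 0))) (lrrlSum t q x y M) U := by
      refine conv_congr (fun S hS => ?_) fun _ _ => rfl
      rw [below_insert haM]
      have : (fun S => x * below M (fun S => maxFirstSum t q (insert a S)) S) =
          below M (fun S => x * maxFirstSum t q (insert a S)) := by
        funext S; simp [below]
      rw [this, ← below_conv]
      unfold below
      split_ifs with h
      · exact lrSum_insert t q x fun ha => haU (hS ha)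
      · rfl
    rw [h1, conv_assoc, conv_const_mul_left]
    congr 2
    refine conv_congr (fun S hS => ?_) fun _ _ => rfl
    unfold below
    split_ifs with h
    · exact lastSum_eq_maxFirstSum t q fun b hb => hU b (hS hb)
    · rfl
  · simp only [if_neg haM]
    rw [conv_const_mul_right]
    -- For `M ≤ a` the letter `a` cannot belong to the first word.
    convert zero_add _
    refine Finset.sum_eq_zero fun S _ => ?_
    beta_reduce
    rw [below_eq_zero (Finset.mem_insert_self a S) (not_lt.mp haM), zero_mul]

theorem pairSum_symm (t q x y : R) (M : ℕ) (T : Finset ℕ) :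
    pairSum t q x y M T = pairSum t q y x M T := by
  induction T using Finset.strongInduction generalizing M with
  | H T ih =>
  rcases T.eq_empty_or_nonempty with rfl | hT
  · simp [pairSum, conv_empty, below, lrSum_empty, lrrlSum, words_empty, lrmax, rlminima]
  obtain ⟨a, ha, hmin⟩ := T.exists_min_image id hT
  simp only [id] at hmin
  obtain ⟨U, haU, rfl⟩ : ∃ V, a ∉ V ∧ T = insert a V :=
    ⟨T.erase a, Finset.notMem_erase _ _, (Finset.insert_erase ha).symm⟩
  have hU : ∀ b ∈ U, a < b := fun b hb =>
    lt_of_le_of_ne (hmin b (Finset.mem_insert_of_mem hb)) fun h => haU (h ▸ hb)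
  have ih : ∀ S ⊆ U, ∀ M, pairSum t q x y M S = pairSum t q y x M S := fun S hS M =>
    ih S (Finset.ssubset_of_subset_of_ssubset hS (Finset.ssubset_insert haU)) M
  have hfirst : conv (below M fun S => maxFirstSum t q (insert a S)) (pairSum t q x y M) U =
      conv (below M fun S => maxFirstSum t q (insert a S)) (pairSum t q y x M) U :=
    conv_congr (fun _ _ => rfl) fun S hS => ih S hS M
  have hsum : ∑ m ∈ U.filter (M ≤ ·), conv (below M (wordSum t q))
        (conv (below m (firstLastSum t q 1 m a)) (pairSum t q x y m)) (U.erase m) =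
      ∑ m ∈ U.filter (M ≤ ·), conv (below M (wordSum t q))
        (conv (below m (firstLastSum t q 1 m a)) (pairSum t q y x m)) (U.erase m) :=
    Finset.sum_congr rfl fun m _ => conv_congr (fun _ _ => rfl) fun S hS =>
      conv_congr (fun _ _ => rfl) fun S' hS' =>
        ih S' (hS'.trans (hS.trans (Finset.erase_subset _ _))) m
  rw [pairSum_insert t q x y M hU, pairSum_insert t q y x M hU, mul_comm y x, add_comm y x,
    ih U le_rfl M, hfirst, hsum]

/-- The number of right-to-left maxima of the part of a word before the letter `a`. -/
def rlmaxBefore (a : ℕ) (w : List ℕ) : ℕ :=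
  rlmax (w.takeWhile (· ≠ a))

theorem rlmaxBefore_append_cons {a : ℕ} {A : List ℕ} (h : a ∉ A) (B : List ℕ) :
    rlmaxBefore a (A ++ a :: B) = rlmax A := by
  rw [rlmaxBefore, List.takeWhile_append_of_pos, List.takeWhile_cons_of_neg (by simp),
    List.append_nil]
  intro b hb
  simpa using fun h' : b = a => h (h' ▸ hb)

/-- On the words with smallest letter `a`, the number of right-to-left maxima before `a`, the
number of descents and the number of double descents have the same joint distribution with the
numbers of left-to-right maxima and of right-to-left minima, taken in either order. -/
theorem sum_words_symm (t q x y z : R) {a : ℕ} {U : Finset ℕ} (hU : ∀ b ∈ U, a < b) :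
    ∑ w ∈ words (insert a U), z ^ rlmaxBefore a w *
        (x ^ lrmax 0 w * y ^ rlminima w * wt t q w) =
      ∑ w ∈ words (insert a U), z ^ rlmaxBefore a w *
        (y ^ lrmax 0 w * x ^ rlminima w * wt t q w) := by
  have haU : a ∉ U := fun ha => lt_irrefl _ (hU a ha)
  have key : ∀ x y : R, ∑ w ∈ words (insert a U), z ^ rlmaxBefore a w *
        (x ^ lrmax 0 w * y ^ rlminima w * wt t q w) =
      x * y * (pairSum t q x y 0 U + ∑ m ∈ U, conv (below m (firstLastSum t q z m a))
        (pairSum t q x y m) (U.erase m)) := by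
    intro x y
    have h := sum_cut_min t q x y z 0 hU
    simp only [Nat.not_lt_zero, if_false, Nat.zero_le, Finset.filter_true] at h
    -- At threshold `0` the first word is empty, so `pairSum` is `lrrlSum`. For each `m`, the part
    -- before `m` supplies the first word of a pair at threshold `m`.
    rw [mul_add, pairSum, below_zero_conv (lrSum_empty t q x 0)]
    simp only [pairSum, conv_left_comm (below _ (firstLastSum t q z _ a))]
    rw [← h, sum_words_insert haU]
    refine Finset.sum_congr rfl fun S hS => Finset.sum_congr rfl fun A hA =>
      Finset.sum_congr rfl fun B _ => ?_
    rw [rlmaxBefore_append_cons fun ha =>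
      haU (Finset.mem_powerset.mp hS ((mem_of_mem_words hA).mp ha))]
  rw [key, key, mul_comm y x, pairSum_symm t q x y]
  congr 2
  exact Finset.sum_congr rfl fun m _ => conv_congr (fun _ _ => rfl) fun S _ =>
    pairSum_symm t q x y m S

end Symmetry

/-! ### Rising factorials and the product formula. -/

section Pochhammer

variable {R : Type*} [CommSemiring R]

theorem reverse_mem_words {T : Finset ℕ} {w : List ℕ} (hw : w ∈ words T) : w.reverse ∈ words T := by
  rw [mem_words] at hw ⊢
  rw [List.nodup_reverse, List.toFinset_reverse]
  exact hw

theorem sum_words_reverse (T : Finset ℕ) (φ : List ℕ → R) :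
    ∑ w ∈ words T, φ w.reverse = ∑ w ∈ words T, φ w :=
  Finset.sum_nbij' List.reverse List.reverse (fun _ => reverse_mem_words)
    (fun _ => reverse_mem_words) (fun w _ => List.reverse_reverse w)
    (fun w _ => List.reverse_reverse w) (fun _ _ => rfl)

theorem sum_words_cons {T : Finset ℕ} (hT : T.Nonempty) (φ : List ℕ → R) :
    ∑ w ∈ words T, φ w = ∑ b ∈ T, ∑ w ∈ words (T.erase b), φ (b :: w) := by
  rw [Finset.sum_sigma']
  symm
  refine Finset.sum_bij (fun p _ => p.1 :: p.2) ?_ ?_ ?_ ?_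
  · rintro ⟨b, w⟩ h
    simp only [Finset.mem_sigma] at h
    rw [mem_words, List.nodup_cons, List.toFinset_cons, (mem_words.mp h.2).2,
      mem_of_mem_words h.2, Finset.insert_erase h.1]
    exact ⟨⟨Finset.notMem_erase _ _, (mem_words.mp h.2).1⟩, rfl⟩
  · rintro ⟨b, w⟩ _ ⟨b', w'⟩ _ he
    obtain ⟨rfl, rfl⟩ := List.cons.inj he
    rfl
  · intro w hw
    obtain ⟨hn, rfl⟩ := mem_words.mp hw
    cases w with
    | nil => simp at hT
    | cons b w =>
      rw [List.nodup_cons] at hn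
      refine ⟨⟨b, w⟩, ?_, rfl⟩
      rw [Finset.mem_sigma, mem_words]
      refine ⟨by simp, hn.2, ?_⟩
      rw [List.toFinset_cons, Finset.erase_insert (by simpa using hn.1)]
  · intros; rfl

theorem sum_words_concat {T : Finset ℕ} (hT : T.Nonempty) (φ : List ℕ → R) :
    ∑ w ∈ words T, φ w = ∑ b ∈ T, ∑ w ∈ words (T.erase b), φ (w ++ [b]) := by
  rw [← sum_words_reverse, sum_words_cons hT]
  refine Finset.sum_congr rfl fun b _ => ?_
  simp only [List.reverse_cons]
  exact sum_words_reverse (T.erase b) fun w => φ (w ++ [b])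

theorem lrmax_concat_of_lt {M b c : ℕ} {w : List ℕ} (hc : c ∈ w) (hbc : b < c) :
    lrmax M (w ++ [b]) = lrmax M w := by
  have aux : ∀ (l : List ℕ) {N : ℕ}, b < N → lrmax N (l ++ [b]) = lrmax N l := by
    intro l
    induction l with
    | nil => intro N hN; simp [lrmax, hN]
    | cons a l ih =>
      intro N hN
      rw [List.cons_append, lrmax, lrmax]
      split_ifs with h
      · rw [ih (hN.trans_le h)]
      · rw [ih hN]
  induction w generalizing M with
  | nil => simp at hc
  | cons a l ih =>
    rw [List.cons_append, lrmax, lrmax]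
    rcases List.mem_cons.mp hc with rfl | hc
    · split_ifs with h
      · rw [aux l hbc]
      · rw [aux l (hbc.trans (not_le.mp h))]
    · split_ifs <;> rw [ih hc]

theorem exists_insert_max {T : Finset ℕ} (hT : T.Nonempty) :
    ∃ m U, T = insert m U ∧ ∀ b ∈ U, b < m := by
  obtain ⟨m, hm, hmax⟩ := T.exists_max_image id hT
  exact ⟨m, T.erase m, (Finset.insert_erase hm).symm, fun b hb =>
    lt_of_le_of_ne (hmax b (Finset.mem_of_mem_erase hb)) (Finset.ne_of_mem_erase hb)⟩

/-- A last letter is a left-to-right maximum exactly when it is the largest letter, so the last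
position contributes `x + (T.card - 1)` for nonempty `T`. -/
theorem sum_pow_lrmax (x : R) (T : Finset ℕ) :
    ∑ w ∈ words T, x ^ lrmax 0 w = (ascPochhammer R T.card).eval x := by
  induction T using Finset.strongInduction with
  | H T ih =>
  rcases T.eq_empty_or_nonempty with rfl | hT
  · simp [words_empty, lrmax]
  rw [sum_words_concat hT]
  obtain ⟨m, U, rfl, hU⟩ := exists_insert_max hT
  have hmU : m ∉ U := fun h => lt_irrefl _ (hU m h)
  have hother : ∀ b ∈ U, ∑ w ∈ words ((insert m U).erase b), x ^ lrmax 0 (w ++ [b]) =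
      (ascPochhammer R U.card).eval x := by
    intro b hb
    have hb' : b ∈ insert m U := Finset.mem_insert_of_mem hb
    have hcard : ((insert m U).erase b).card = U.card := by
      rw [Finset.card_erase_of_mem hb', Finset.card_insert_of_notMem hmU, Nat.add_sub_cancel]
    rw [← hcard, ← ih _ (Finset.erase_ssubset hb')]
    refine Finset.sum_congr rfl fun w hw => ?_
    rw [lrmax_concat_of_lt ((mem_of_mem_words hw).mpr
      (Finset.mem_erase.mpr ⟨(hU b hb).ne', Finset.mem_insert_self _ _⟩)) (hU b hb)]
  rw [Finset.sum_insert hmU, Finset.sum_congr rfl hother, Finset.erase_insert hmU,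
    Finset.card_insert_of_notMem hmU, ascPochhammer_succ_eval,
    ← ih U (Finset.ssubset_insert hmU), Finset.sum_const, nsmul_eq_mul, mul_add,
    mul_comm (U.card : R)]
  congr 1
  rw [Finset.sum_mul]
  refine Finset.sum_congr rfl fun w hw => ?_
  rw [lrmax_append_cons (Nat.zero_le m) fun b hb => hU b ((mem_of_mem_words hw).mp hb), lrmax,
    add_zero, pow_succ]

theorem sum_pow_rlmax (y : R) (T : Finset ℕ) :
    ∑ w ∈ words T, y ^ rlmax w = (ascPochhammer R T.card).eval y := by
  induction T using Finset.strongInduction with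
  | H T ih =>
  rcases T.eq_empty_or_nonempty with rfl | hT
  · simp [words_empty, rlmax]
  rw [sum_words_cons hT]
  obtain ⟨m, U, rfl, hU⟩ := exists_insert_max hT
  have hmU : m ∉ U := fun h => lt_irrefl _ (hU m h)
  have hother : ∀ b ∈ U, ∑ w ∈ words ((insert m U).erase b), y ^ rlmax (b :: w) =
      (ascPochhammer R U.card).eval y := by
    intro b hb
    have hb' : b ∈ insert m U := Finset.mem_insert_of_mem hb
    have hcard : ((insert m U).erase b).card = U.card := by
      rw [Finset.card_erase_of_mem hb', Finset.card_insert_of_notMem hmU, Nat.add_sub_cancel]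
    rw [← hcard, ← ih _ (Finset.erase_ssubset hb')]
    refine Finset.sum_congr rfl fun w hw => ?_
    rw [rlmax, if_neg, add_zero]
    intro h
    refine absurd (h m ((mem_of_mem_words hw).mpr ?_)) (not_lt.mpr (hU b hb).le)
    exact Finset.mem_erase.mpr ⟨(hU b hb).ne', Finset.mem_insert_self _ _⟩
  rw [Finset.sum_insert hmU, Finset.sum_congr rfl hother, Finset.erase_insert hmU,
    Finset.card_insert_of_notMem hmU, ascPochhammer_succ_eval,
    ← ih U (Finset.ssubset_insert hmU), Finset.sum_const, nsmul_eq_mul, mul_add,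
    mul_comm (U.card : R)]
  congr 1
  rw [Finset.sum_mul]
  refine Finset.sum_congr rfl fun w hw => ?_
  rw [rlmax, if_pos fun b hb => hU b ((mem_of_mem_words hw).mp hb), pow_succ]

/-- The Vandermonde identity for rising factorials: a new point joins the first block with factor `x
+ S.card` or the second with factor `y + (T \ S).card`, and these add up to `x + y + T.card`. -/
theorem conv_ascPochhammer (x y : R) (T : Finset ℕ) :
    conv (fun S => (ascPochhammer R S.card).eval x) (fun S => (ascPochhammer R S.card).eval y) T =
      (ascPochhammer R T.card).eval (x + y) := by
  induction T using Finset.induction_on with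
  | empty => simp [conv_empty]
  | insert a T ha ih =>
    rw [conv_insert _ _ ha, Finset.card_insert_of_notMem ha, ascPochhammer_succ_eval, ← ih]
    simp only [conv]
    rw [← Finset.sum_add_distrib, Finset.sum_mul]
    refine Finset.sum_congr rfl fun S hS => ?_
    have hS := Finset.mem_powerset.mp hS
    have hcard : (T.card : R) = S.card + (T \ S).card := by
      rw [← Nat.cast_add, add_comm, Finset.card_sdiff_add_card_eq_card hS]
    rw [Finset.card_insert_of_notMem fun h => ha (hS h),
      Finset.card_insert_of_notMem fun h => ha (Finset.sdiff_subset h), ascPochhammer_succ_eval,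
      ascPochhammer_succ_eval, hcard]
    ring

/-- The largest letter `m` separates the two statistics: left-to-right maxima other than `m` lie
before it, right-to-left maxima other than `m` after it. The `- 1` discards `m` on the left, while
on the right it gives the factor `y`. -/
theorem sum_pow_lrmax_mul_pow_rlmax (x y : R) {m : ℕ} {U : Finset ℕ} (hU : ∀ b ∈ U, b < m) :
    ∑ w ∈ words (insert m U), x ^ (lrmax 0 w - 1) * y ^ rlmax w =
      y * (ascPochhammer R U.card).eval (x + y) := by
  rw [sum_words_insert fun h => lt_irrefl _ (hU m h), ← conv_ascPochhammer, conv, Finset.mul_sum]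
  refine Finset.sum_congr rfl fun S hS => ?_
  have hS := Finset.mem_powerset.mp hS
  rw [← sum_pow_lrmax, ← sum_pow_rlmax, Finset.sum_mul_sum, Finset.mul_sum]
  refine Finset.sum_congr rfl fun A hA => ?_
  rw [Finset.mul_sum]
  refine Finset.sum_congr rfl fun B hB => ?_
  have hA' : ∀ b ∈ A, b < m := fun b hb => hU b (hS ((mem_of_mem_words hA).mp hb))
  have hB' : ∀ b ∈ B, b < m := fun b hb =>
    hU b (Finset.sdiff_subset ((mem_of_mem_words hB).mp hb))
  rw [lrmax_append_cons (Nat.zero_le m) hA', lrmax_eq_zero hB', rlmax_append_cons hA' hB',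
    add_zero, Nat.add_sub_cancel]
  ring

theorem rlmaxBefore_concat {a : ℕ} {w : List ℕ} (ha : a ∈ w) (b : ℕ) :
    rlmaxBefore a (w ++ [b]) = rlmaxBefore a w := by
  obtain ⟨A, B, rfl, hA⟩ := List.eq_append_cons_of_mem ha
  rw [List.append_assoc, List.cons_append, rlmaxBefore_append_cons hA, rlmaxBefore_append_cons hA]

/-- Classification by the last letter. A letter other than `a` and the largest `m` changes neither
statistic; `m` adds a left-to-right maximum. If `a` is last, everything else precedes it and
`sum_pow_lrmax_mul_pow_rlmax` applies. The total factor is `x + y + V.card`. -/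
theorem sum_pow_lrmax_mul_pow_rlmaxBefore (x y : R) {a : ℕ} {U : Finset ℕ}
    (hU : ∀ b ∈ U, a < b) :
    ∑ w ∈ words (insert a U), x ^ (lrmax 0 w - 1) * y ^ rlmaxBefore a w =
      (ascPochhammer R U.card).eval (x + y) := by
  induction U using Finset.strongInduction with
  | H U ih =>
  rcases U.eq_empty_or_nonempty with rfl | hne
  · rw [sum_words_cons (by simp)]
    simp [words_empty, lrmax, rlmaxBefore, rlmax]
  have haU : a ∉ U := fun ha => lt_irrefl _ (hU a ha)
  obtain ⟨m, V, rfl, hV⟩ := exists_insert_max hne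
  have hmV : m ∉ V := fun h => lt_irrefl _ (hV m h)
  have ham : a < m := hU m (Finset.mem_insert_self _ _)
  have hmem : ∀ {b : ℕ}, b ∈ insert m V → ∀ {w : List ℕ},
      w ∈ words ((insert a (insert m V)).erase b) → a ∈ w := fun {b} hb {w} hw =>
    (mem_of_mem_words hw).mpr (Finset.mem_erase.mpr ⟨(hU b hb).ne, Finset.mem_insert_self _ _⟩)
  have hother : ∀ b ∈ V, ∑ w ∈ words ((insert a (insert m V)).erase b),
      x ^ (lrmax 0 (w ++ [b]) - 1) * y ^ rlmaxBefore a (w ++ [b]) =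
        (ascPochhammer R V.card).eval (x + y) := by
    intro b hb
    have hb' : b ∈ insert m V := Finset.mem_insert_of_mem hb
    have hcard : ((insert m V).erase b).card = V.card := by
      rw [Finset.card_erase_of_mem hb', Finset.card_insert_of_notMem hmV, Nat.add_sub_cancel]
    rw [← hcard, ← ih _ (Finset.erase_ssubset hb') fun c hc => hU c (Finset.mem_of_mem_erase hc),
      ← Finset.erase_insert_of_ne (hU b hb').ne]
    refine Finset.sum_congr rfl fun w hw => ?_
    rw [rlmaxBefore_concat (hmem hb' hw), lrmax_concat_of_lt ((mem_of_mem_words hw).mpr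
      (Finset.mem_erase.mpr ⟨(hV b hb).ne', by simp⟩)) (hV b hb)]
  have hlast : ∑ w ∈ words ((insert a (insert m V)).erase a),
      x ^ (lrmax 0 (w ++ [a]) - 1) * y ^ rlmaxBefore a (w ++ [a]) =
        y * (ascPochhammer R V.card).eval (x + y) := by
    rw [Finset.erase_insert haU, ← sum_pow_lrmax_mul_pow_rlmax x y hV]
    refine Finset.sum_congr rfl fun w hw => ?_
    rw [rlmaxBefore_append_cons fun h => haU ((mem_of_mem_words hw).mp h),
      lrmax_concat_of_lt ((mem_of_mem_words hw).mpr (Finset.mem_insert_self _ _)) ham]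
  have hmax : ∑ w ∈ words ((insert a (insert m V)).erase m),
      x ^ (lrmax 0 (w ++ [m]) - 1) * y ^ rlmaxBefore a (w ++ [m]) =
        x * (ascPochhammer R V.card).eval (x + y) := by
    rw [← ih V (Finset.ssubset_insert hmV) fun c hc => hU c (Finset.mem_insert_of_mem hc),
      Finset.mul_sum]
    have hset : (insert a (insert m V)).erase m = insert a V := by
      rw [Finset.erase_insert_of_ne ham.ne, Finset.erase_insert hmV]
    refine Finset.sum_congr (by rw [hset]) fun w hw => ?_
    have haw : a ∈ w := (mem_of_mem_words hw).mpr (Finset.mem_insert_self _ _)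
    have hwm : ∀ b ∈ w, b < m := by
      intro b hb
      rcases Finset.mem_insert.mp ((mem_of_mem_words hw).mp hb) with rfl | hb
      · exact ham
      · exact hV b hb
    -- The first letter is always counted, so the subtraction in the exponent is not truncated and a
    -- genuine factor `x` can be extracted.
    have hpos : 1 ≤ lrmax 0 w := by
      cases w with
      | nil => simp at haw
      | cons b l => simp [lrmax]
    rw [rlmaxBefore_concat haw, lrmax_append_cons (Nat.zero_le m) hwm, lrmax, add_zero,
      Nat.add_sub_cancel, ← mul_assoc, ← pow_succ', Nat.sub_add_cancel hpos]
  rw [sum_words_concat (Finset.insert_nonempty _ _), Finset.sum_insert haU, Finset.sum_insert hmV,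
    hlast, hmax, Finset.sum_congr rfl hother, Finset.card_insert_of_notMem hmV,
    ascPochhammer_succ_eval, Finset.sum_const, nsmul_eq_mul]
  ring

end Pochhammer

/-! ### From words back to permutations. -/

section Transfer

variable {n : ℕ}

/-- The word of a permutation, with the letters `0, …, n - 1`. -/
def toWord (π : Equiv.Perm (Fin n)) : List ℕ :=
  List.ofFn fun i => (π i : ℕ)

theorem sum_toWord {R : Type*} [CommSemiring R] (φ : List ℕ → R) :
    ∑ π : Equiv.Perm (Fin n), φ (toWord π) = ∑ w ∈ words (Finset.range n), φ w := by
  refine Finset.sum_bij (fun π _ => toWord π) ?_ ?_ ?_ ?_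
  · intro π _
    rw [mem_words, toWord, List.nodup_ofFn]
    refine ⟨fun i j h => π.injective (Fin.ext h), ?_⟩
    ext b
    simp only [List.mem_toFinset, List.mem_ofFn, Finset.mem_range]
    constructor
    · rintro ⟨i, rfl⟩; exact (π i).2
    · intro hb; exact ⟨π.symm ⟨b, hb⟩, by simp⟩
  · intro π _ σ _ h
    have := List.ofFn_injective h
    ext i
    exact congrFun this i
  · intro w hw
    have hlen : w.length = n := by rw [length_of_mem_words hw, Finset.card_range]
    subst hlen
    have hlt : ∀ i : Fin w.length, w.get i < w.length := fun i =>
      Finset.mem_range.mp ((mem_of_mem_words hw).mp (w.get_mem i))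
    have hinj : Function.Injective fun i : Fin w.length => (⟨w.get i, hlt i⟩ : Fin w.length) :=
      fun i j h => (mem_words.mp hw).1.injective_get (Fin.mk.inj_iff.mp h)
    refine ⟨Equiv.ofBijective _ (Finite.injective_iff_bijective.mp hinj), Finset.mem_univ _, ?_⟩
    simp [toWord]
  · intros; rfl

/-- The inequality is weak because `lrmax` counts repeated maxima; for permutations, injectivity
makes it strict. -/
theorem lrmax_ofFn (M : ℕ) (f : Fin n → ℕ) : lrmax M (List.ofFn f) =
    (Finset.univ.filter fun i => M ≤ f i ∧ ∀ j, j < i → f j ≤ f i).card := by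
  induction n generalizing M with
  | zero => simp [lrmax]
  | succ n ih =>
    rw [List.ofFn_succ, lrmax, Fin.card_filter_univ_succ, ih, ih]
    simp only [Fin.forall_fin_succ, Fin.succ_pos, Fin.succ_lt_succ_iff, Fin.not_lt_zero,
      false_imp_iff, implies_true, and_true, forall_const]
    split_ifs with h
    · congr 1
      refine congrArg Finset.card (Finset.ext fun i => ?_)
      simp only [Finset.mem_filter, Finset.mem_univ, true_and]
      exact ⟨fun hi => ⟨h.trans hi.1, hi⟩, fun hi => hi.2⟩
    · refine congrArg Finset.card (Finset.ext fun i => ?_)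
      simp only [Finset.mem_filter, Finset.mem_univ, true_and]
      exact ⟨fun hi => ⟨hi.1, (not_le.mp h).le.trans hi.1, hi.2⟩, fun hi => ⟨hi.1, hi.2.2⟩⟩

theorem rlminima_ofFn (f : Fin n → ℕ) : rlminima (List.ofFn f) =
    (Finset.univ.filter fun i => ∀ j, i < j → f i < f j).card := by
  induction n with
  | zero => simp [rlminima]
  | succ n ih =>
    rw [List.ofFn_succ, rlminima, Fin.card_filter_univ_succ, ih]
    simp only [Fin.forall_fin_succ, Fin.succ_pos, Fin.succ_lt_succ_iff, Fin.not_lt_zero,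
      forall_const, List.forall_mem_ofFn_iff, lt_irrefl, false_imp_iff, true_and]
    split_ifs <;> rfl

theorem forall_mem_takeWhile_ofFn {f : Fin n → ℕ} (hf : Function.Injective f) (p : Fin n) (b : ℕ) :
    (∀ c ∈ (List.ofFn f).takeWhile (· ≠ f p), c < b) ↔ ∀ j, j < p → f j < b := by
  induction n with
  | zero => exact p.elim0
  | succ n ih =>
    rw [List.ofFn_succ]
    induction p using Fin.cases with
    | zero => simp
    | succ p =>
      have hne : f 0 ≠ f p.succ := fun h => absurd (hf h) (Fin.succ_ne_zero p).symm
      have := ih (hf.comp (Fin.succ_injective n)) p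
      rw [List.takeWhile_cons_of_pos (by simpa using hne), List.forall_mem_cons,
        Fin.forall_fin_succ]
      simp only [Fin.succ_pos, Fin.succ_lt_succ_iff, forall_const]
      exact and_congr_right fun _ => this

theorem rlmaxBefore_ofFn {f : Fin n → ℕ} (hf : Function.Injective f) (p : Fin n) :
    rlmaxBefore (f p) (List.ofFn f) =
      (Finset.univ.filter fun i => i < p ∧ ∀ j, i < j → j < p → f j < f i).card := by
  induction n with
  | zero => exact p.elim0
  | succ n ih =>
    rw [List.ofFn_succ, Fin.card_filter_univ_succ, rlmaxBefore]
    induction p using Fin.cases with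
    | zero => simp [rlmax]
    | succ p =>
      have hne : f 0 ≠ f p.succ := fun h => absurd (hf h) (Fin.succ_ne_zero p).symm
      have hs := hf.comp (Fin.succ_injective n)
      have h1 := ih hs p
      have h2 := forall_mem_takeWhile_ofFn hs p (f 0)
      simp only [Function.comp_def] at h1 h2
      rw [List.takeWhile_cons_of_pos (by simpa using hne), rlmax]
      rw [rlmaxBefore] at h1
      rw [h1]
      simp only [h2, Fin.forall_fin_succ, Fin.succ_pos, Fin.succ_lt_succ_iff, Fin.not_lt_zero,
        forall_const, lt_irrefl, false_imp_iff, true_and]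
      split_ifs <;> rfl

/-- The number of descents of a sequence. -/
def descents (f : Fin n → ℕ) : ℕ :=
  (Finset.univ.filter fun i : Fin n => ∃ j : Fin n, (j : ℕ) = (i : ℕ) + 1 ∧ f j < f i).card

/-- The number of consecutive double descents of a sequence. -/
def doubleDescents (f : Fin n → ℕ) : ℕ :=
  (Finset.univ.filter fun i : Fin n => ∃ j k : Fin n,
    (j : ℕ) = (i : ℕ) + 1 ∧ (k : ℕ) = (i : ℕ) + 2 ∧ f j < f i ∧ f k < f j).card

theorem descents_succ (f : Fin (n + 2) → ℕ) :
    descents f = descents (fun i => f i.succ) + if f 1 < f 0 then 1 else 0 := by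
  rw [descents, Fin.card_filter_univ_succ]
  have h0 : (∃ j : Fin (n + 2), (j : ℕ) = ((0 : Fin (n + 2)) : ℕ) + 1 ∧ f j < f 0) ↔
      f 1 < f 0 := by
    constructor
    · rintro ⟨j, hj, h⟩
      have : j = 1 := Fin.ext (by simpa using hj)
      rwa [this] at h
    · exact fun h => ⟨1, by simp, h⟩
  have hs : ∀ i : Fin (n + 1), (∃ j : Fin (n + 2), (j : ℕ) = (i.succ : ℕ) + 1 ∧ f j < f i.succ) ↔
      ∃ j : Fin (n + 1), (j : ℕ) = (i : ℕ) + 1 ∧ f j.succ < f i.succ := fun i => by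
    rw [Fin.exists_fin_succ]
    simp
  simp only [h0, hs, descents]
  split_ifs <;> rfl

theorem doubleDescents_succ (f : Fin (n + 3) → ℕ) :
    doubleDescents f =
      doubleDescents (fun i => f i.succ) + if f 1 < f 0 ∧ f 2 < f 1 then 1 else 0 := by
  rw [doubleDescents, Fin.card_filter_univ_succ]
  have h0 : (∃ j k : Fin (n + 3), (j : ℕ) = ((0 : Fin (n + 3)) : ℕ) + 1 ∧
      (k : ℕ) = ((0 : Fin (n + 3)) : ℕ) + 2 ∧ f j < f 0 ∧ f k < f j) ↔
      f 1 < f 0 ∧ f 2 < f 1 := by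
    constructor
    · rintro ⟨j, k, hj, hk, h⟩
      have hj : j = 1 := Fin.ext (by simpa using hj)
      have hk : k = 2 := Fin.ext (by rw [hk, Fin.val_zero, Fin.val_two])
      rwa [hj, hk] at h
    · exact fun h => ⟨1, 2, by simp, by simp, h⟩
  have hs : ∀ i : Fin (n + 2), (∃ j k : Fin (n + 3), (j : ℕ) = (i.succ : ℕ) + 1 ∧
      (k : ℕ) = (i.succ : ℕ) + 2 ∧ f j < f i.succ ∧ f k < f j) ↔
      ∃ j k : Fin (n + 2), (j : ℕ) = (i : ℕ) + 1 ∧ (k : ℕ) = (i : ℕ) + 2 ∧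
        f j.succ < f i.succ ∧ f k.succ < f j.succ := fun i => by
    simp only [Fin.exists_fin_succ (n := n + 2), Fin.val_succ, Fin.val_zero]
    simp
  simp only [h0, hs, doubleDescents]
  split_ifs <;> rfl

theorem descents_of_le_one (hn : n ≤ 1) (f : Fin n → ℕ) : descents f = 0 := by
  rw [descents, Finset.card_eq_zero, Finset.filter_eq_empty_iff]
  rintro i - ⟨j, hj, -⟩
  omega

theorem doubleDescents_of_le_two (hn : n ≤ 2) (f : Fin n → ℕ) : doubleDescents f = 0 := by
  rw [doubleDescents, Finset.card_eq_zero, Finset.filter_eq_empty_iff]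
  rintro i - ⟨j, k, hj, hk, -⟩
  omega

theorem wt_ofFn {R : Type*} [CommSemiring R] (t q : R) (f : Fin n → ℕ) :
    wt t q (List.ofFn f) = t ^ descents f * q ^ doubleDescents f := by
  induction n with
  | zero => simp [wt, descents_of_le_one, doubleDescents_of_le_two]
  | succ n ih =>
    match n with
    | 0 => simp [wt, descents_of_le_one, doubleDescents_of_le_two]
    | 1 =>
      rw [descents_succ, descents_of_le_one le_rfl, doubleDescents_of_le_two le_rfl]
      simp [wt]
    | n + 2 =>
      have := ih fun i => f i.succ
      simp only [List.ofFn_succ, wt] at this ⊢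
      rw [this, descents_succ f, doubleDescents_succ f]
      change _ = t ^ (_ + if f (Fin.succ 0) < f 0 then 1 else 0) *
        q ^ (_ + if f (Fin.succ 0) < f 0 ∧ f (Fin.succ (Fin.succ 0)) < f (Fin.succ 0) then 1 else 0)
      simp only [pow_add, pow_ite, pow_one, pow_zero]
      ring

/-- Pigeonhole: all values smaller than `π i` sit at positions before `i`. If one of these positions
held a larger value, there would be fewer than `i` such values, against `i ≤ π i`. -/
theorem exists_lt_of_lt_apply {π : Equiv.Perm (Fin n)} {i : Fin n} (h : ∀ k, i < k → π i < π k)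
    (hi : i ≤ π i) {j : Fin n} (hj : j < i) : π j < π i := by
  by_contra hc
  have hsub : (Finset.Iio (π i)).image π.symm ⊆ (Finset.Iio i).erase j := by
    intro k hk
    obtain ⟨v, hv, rfl⟩ := Finset.mem_image.mp hk
    have hv := Finset.mem_Iio.mp hv
    rw [Finset.mem_erase, Finset.mem_Iio]
    refine ⟨?_, ?_⟩
    · rintro rfl
      rw [Equiv.apply_symm_apply] at hc
      exact hc hv
    · refine lt_of_le_of_ne (not_lt.mp fun hlt => ?_) ?_
      · have := h _ hlt
        rw [Equiv.apply_symm_apply] at this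
        exact absurd this (not_lt.mpr hv.le)
      · rintro rfl
        rw [Equiv.apply_symm_apply] at hv
        exact lt_irrefl _ hv
  have hcard := Finset.card_le_card hsub
  rw [Finset.card_image_of_injective _ π.symm.injective,
    Finset.card_erase_of_mem (Finset.mem_Iio.mpr hj), Fin.card_Iio, Fin.card_Iio] at hcard
  have h1 : (j : ℕ) < i := hj
  have h2 : (i : ℕ) ≤ π i := hi
  omega

/-- The weak excedances that are not mid-points are the left-to-right maxima. -/
theorem isWeakExcedance_and_not_isMidPoint_iff (π : Equiv.Perm (Fin n)) (i : Fin n) :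
    IsWeakExcedance π i ∧ ¬ IsMidPoint π i ↔ ∀ j, j < i → π j < π i := by
  constructor
  · rintro ⟨hi, hm⟩ j hj
    by_contra hc
    have hc : π i < π j := lt_of_le_of_ne (not_lt.mp hc) fun h => hj.ne' (π.injective h)
    refine absurd (exists_lt_of_lt_apply (fun k hk => ?_) hi hj) (not_lt.mpr hc.le)
    by_contra hk'
    exact hm ⟨⟨j, hj, hc⟩, k, hk,
      lt_of_le_of_ne (not_lt.mp hk') fun h => hk.ne' (π.injective h)⟩
  · intro h
    refine ⟨?_, fun hm => ?_⟩
    -- The values at the positions before `i` are distinct and smaller than `π i`, which forces `i ≤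
    -- π i`.
    · have hsub : (Finset.Iio i).image π ⊆ Finset.Iio (π i) := by
        intro v hv
        obtain ⟨j, hj, rfl⟩ := Finset.mem_image.mp hv
        exact Finset.mem_Iio.mpr (h j (Finset.mem_Iio.mp hj))
      have hcard := Finset.card_le_card hsub
      rwa [Finset.card_image_of_injective _ π.injective, Fin.card_Iio, Fin.card_Iio] at hcard
    · obtain ⟨⟨j, hj, hlt⟩, -⟩ := hm
      exact absurd (h j hj) (not_lt.mpr hlt.le)

theorem lrmax_toWord (π : Equiv.Perm (Fin n)) : lrmax 0 (toWord π) = wnm π := by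
  rw [wnm, WNM, Finset.card_image_of_injective _ π.injective, toWord, lrmax_ofFn]
  refine congrArg Finset.card (Finset.filter_congr fun i _ => ?_)
  rw [isWeakExcedance_and_not_isMidPoint_iff]
  simp only [Nat.zero_le, true_and, Fin.val_fin_le]
  exact forall₂_congr fun j hj =>
    ⟨fun h => lt_of_le_of_ne h fun h' => hj.ne (π.injective h'), le_of_lt⟩

theorem rlminima_toWord (π : Equiv.Perm (Fin n)) : rlminima (toWord π) = rlmin π := by
  rw [rlmin, RLMIN, Finset.card_image_of_injective _ π.injective, toWord, rlminima_ofFn]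
  simp only [Fin.val_fin_lt]

theorem rlmaxBefore_toWord (hn : 1 ≤ n) (π : Equiv.Perm (Fin n)) :
    rlmaxBefore 0 (toWord π) = rlm π := by
  rw [rlm, RLM, Finset.card_image_of_injective _ π.injective, toWord]
  have hinj : Function.Injective fun i => (π i : ℕ) := fun i j h => π.injective (Fin.ext h)
  have hp : (π (π.symm ⟨0, hn⟩) : ℕ) = 0 := by simp
  have := rlmaxBefore_ofFn hinj (π.symm ⟨0, hn⟩)
  simp only [hp] at this
  rw [this]
  refine congrArg Finset.card (Finset.filter_congr fun i _ => ⟨fun h => ⟨_, hp, h⟩, ?_⟩)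
  rintro ⟨p, hp', h⟩
  have : p = π.symm ⟨0, hn⟩ := hinj (hp'.trans hp.symm)
  subst this
  exact h

theorem wt_toWord {R : Type*} [CommSemiring R] (t q : R) (π : Equiv.Perm (Fin n)) :
    wt t q (toWord π) = t ^ des π * q ^ consec321 π := by
  rw [toWord, wt_ofFn]
  rfl

theorem range_eq_insert (hn : 1 ≤ n) : Finset.range n = insert 0 (Finset.Ico 1 n) := by
  ext b
  simp only [Finset.mem_range, Finset.mem_insert, Finset.mem_Ico]
  omega

theorem sum_perm_symm {R : Type*} [CommSemiring R] (hn : 1 ≤ n) (x y z t q : R) :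
    ∑ π : Equiv.Perm (Fin n),
        z ^ rlm π * (x ^ wnm π * y ^ rlmin π * (t ^ des π * q ^ consec321 π)) =
      ∑ π : Equiv.Perm (Fin n),
        z ^ rlm π * (y ^ wnm π * x ^ rlmin π * (t ^ des π * q ^ consec321 π)) := by
  have h := sum_words_symm t q x y z (a := 0) (U := Finset.Ico 1 n)
    fun b hb => (Finset.mem_Ico.mp hb).1
  rw [← range_eq_insert hn, ← sum_toWord, ← sum_toWord] at h
  simpa only [lrmax_toWord, rlminima_toWord, rlmaxBefore_toWord hn, wt_toWord] using h

end Transfer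

end PermStat

/-! ### Conclusion: coefficients and specialization. -/

theorem mainTheorem1 (n : ℕ) (hn : 1 ≤ n) :
    (∀ v : ℕ × ℕ × ℕ × ℕ × ℕ,
      (Finset.univ.filter fun π : Equiv.Perm (Fin n) =>
        (PermStat.rlm π, PermStat.rlmin π, PermStat.wnm π, PermStat.des π,
          PermStat.consec321 π) = v).card =
      (Finset.univ.filter fun π : Equiv.Perm (Fin n) =>
        (PermStat.rlm π, PermStat.wnm π, PermStat.rlmin π, PermStat.des π,
          PermStat.consec321 π) = v).card) ∧
    (∀ {R : Type*} [CommSemiring R] (x y : R),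
      ∑ π : Equiv.Perm (Fin n), x ^ (PermStat.wnm π - 1) * y ^ PermStat.rlm π =
        (ascPochhammer R (n - 1)).eval (x + y)) := by
  refine ⟨fun v => ?_, fun {R} _ x y => ?_⟩
  -- The five variables become independent monomials whose exponent vectors record the statistics,
  -- so the coefficient at `v` counts permutations. The variable `x` takes the third coordinate and
  -- `y` the second, so the left side records `rlmin` before `wnm` and the right side `wnm` before
  -- `rlmin`.
  · have h := PermStat.sum_perm_symm (R := AddMonoidAlgebra ℕ (ℕ × ℕ × ℕ × ℕ × ℕ)) hn
      (.single (0, 0, 1, 0, 0) 1) (.single (0, 1, 0, 0, 0) 1) (.single (1, 0, 0, 0, 0) 1)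
      (.single (0, 0, 0, 1, 0) 1) (.single (0, 0, 0, 0, 1) 1)
    have h := congrArg (fun f => f.coeff v) h
    simpa [AddMonoidAlgebra.single_pow, AddMonoidAlgebra.single_mul_single, Finsupp.single_apply] using h
  · have h := PermStat.sum_pow_lrmax_mul_pow_rlmaxBefore x y (a := 0) (U := Finset.Ico 1 n)
      fun b hb => (Finset.mem_Ico.mp hb).1
    rw [← PermStat.range_eq_insert hn, ← PermStat.sum_toWord, Nat.card_Ico] at h
    simpa only [PermStat.lrmax_toWord, PermStat.rlmaxBefore_toWord hn] using h
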